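/- Let $N\in\mathbb{N}_0$, let $x_1<\dots<x_N$ be real numbers, and let $\omega_n\in\mathbb{R}$, $\upsilon_n\ge 0$ with $|\omega_n|+\upsilon_n>0$ for $n=1,\dots,N$; consider the finite discrete measures $$\omega=\sum_{n=1}^N\omega_n\delta_{x_n},\qquad \upsilon=\sum_{n=1}^N\upsilon_n\delta_{x_n}\qquad(\ast)$$ and, for $z\in\mathbb{C}$, the differential equation $$-f''+\tfrac14 f=z\,\omega f+z^2\upsilon f\quad\text{on }\mathbb{R},$$ where a solution is a continuous function $f:\mathbb{R}\to\mathbb{C}$ with $-f''+\frac14 f=0$ on $\mathbb{R}\setminus\{x_1,\dots,x_N\}$ and $f'(x_n-)=(z\omega_n+z^2\upsilon_n)f(x_n)+f'(x_n+)$ for $n=1,\dots,N$. The spectrum of the pair $(\omega,\upsilon)$ is the set of all $z\in\mathbb{C}$ for which there is a nontrivial bounded solution. For $z\in\mathbb{C}$ let $\phi_+(z,\cdot)$ be the solution with $\phi_+(z,x)=e^{-x/2}$ for all $x$ near $+\infty$. The norming constant associated with a real point $\lambda$ of the spectrum is $$\int_{\mathbb{R}}|\phi_+(\lambda,x)|^2\,d\omega(x)+2\lambda\int_{\mathbb{R}}|\phi_+(\lambda,x)|^2\,d\upsilon(x).$$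 **Theorem.** Let $\sigma$ be a finite subset of $\mathbb{R}$ and for each $\lambda\in\sigma$ let $\gamma_\lambda^2\in\mathbb{R}$ be such that $\lambda\gamma_\lambda^2>0$. Then there are unique measures $\omega$ and $\upsilon$ of the form $(\ast)$ (for some $N$, $x_n$, $\omega_n$, $\upsilon_n$ as above) such that the corresponding spectrum is $\sigma$ and the norming constant associated with each $\lambda\in\sigma$ is $\gamma_\lambda^2$. -/

import Mathlib

open MeasureTheory Filter Topology

noncomputable section

namespace GeneralizedSpectralProblem

/-- The pair `(ω, υ)` is of the form `ω = ∑ₙ ωₙ δ_{xₙ}`, `υ = ∑ₙ υₙ δ_{xₙ}` with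
`x₁ < ⋯ < x_N` real, `ωₙ ∈ ℝ`, `υₙ ≥ 0` and `|ωₙ| + υₙ > 0` for every `n` (and `N ≥ 0`). -/
def IsDiscretePair (ω : SignedMeasure ℝ) (υ : Measure ℝ) : Prop :=
  ∃ (N : ℕ) (x w v : Fin N → ℝ),
    StrictMono x ∧ (∀ n, 0 ≤ v n) ∧ (∀ n, 0 < |w n| + v n) ∧
    ω = ∑ n, VectorMeasure.dirac (x n) (w n) ∧
    υ = ∑ n, ENNReal.ofReal (v n) • Measure.dirac (x n)

/-- The set of point masses of `|ω| + υ`, which is `{x₁, …, x_N}` for a discrete pair. -/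
def atoms (ω : SignedMeasure ℝ) (υ : Measure ℝ) : Set ℝ :=
  {x | ω {x} ≠ 0 ∨ υ {x} ≠ 0}

/-- `f` is a solution of `-f'' + f / 4 = z ω f + z² υ f`: the equation `-f'' + f / 4 = 0` holds
off the point masses, and at each point mass `x` the function `f` is continuous, `f'` has
one-sided limits and `f'(x-) = (z ω({x}) + z² υ({x})) f(x) + f'(x+)`. -/
structure IsSolution (ω : SignedMeasure ℝ) (υ : Measure ℝ) (z : ℂ) (f : ℝ → ℂ) : Prop where
  ode : ∀ x ∉ atoms ω υ, DifferentiableAt ℝ f x ∧ DifferentiableAt ℝ (deriv f) x ∧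
    -deriv (deriv f) x + (1 / 4) * f x = 0
  interface : ∀ x ∈ atoms ω υ, ContinuousAt f x ∧ ∃ dl dr : ℂ,
    Tendsto (deriv f) (𝓝[<] x) (𝓝 dl) ∧ Tendsto (deriv f) (𝓝[>] x) (𝓝 dr) ∧
    dl = (z * (ω {x} : ℂ) + z ^ 2 * (υ.real {x} : ℂ)) * f x + dr

/-- The spectrum: all `z ∈ ℂ` for which there is a nontrivial bounded solution. -/
def spectrum (ω : SignedMeasure ℝ) (υ : Measure ℝ) : Set ℂ :=
  {z | ∃ f : ℝ → ℂ, IsSolution ω υ z f ∧ f ≠ 0 ∧ ∃ C : ℝ, ∀ x, ‖f x‖ ≤ C}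

/-- `φ` is the solution `φ₊(z, ·)`, that is, the solution with `φ(x) = e^{-x/2}` for all `x`
near `+∞`. -/
def IsPhiPlus (ω : SignedMeasure ℝ) (υ : Measure ℝ) (z : ℂ) (φ : ℝ → ℂ) : Prop :=
  IsSolution ω υ z φ ∧ ∀ᶠ x : ℝ in atTop, φ x = (Real.exp (-x / 2) : ℂ)

/-- `c` is the (modified) norming constant at the real point `lam`:
`c = ∫ |φ₊(lam, x)|² dω(x) + 2 lam ∫ |φ₊(lam, x)|² dυ(x)`. -/
def IsNormingConstant (ω : SignedMeasure ℝ) (υ : Measure ℝ) (lam c : ℝ) : Prop :=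
  ∃ φ : ℝ → ℂ, IsPhiPlus ω υ (lam : ℂ) φ ∧
    c = VectorMeasure.integral ω (fun x => ‖φ x‖ ^ 2) (ContinuousLinearMap.lsmul ℝ ℝ)
      + 2 * lam * ∫ x, ‖φ x‖ ^ 2 ∂υ

end GeneralizedSpectralProblem

end

/-! Left of all masses, `φ₊(z, ·)` is `z a(z) e^{x/2} + b(z) e^{-x/2}` with real polynomials `a, b`
and `b(0) = 1`. A bounded solution must be a multiple of `φ₊` by its behaviour at `+∞`, so the
spectrum is the zero set of `b`. The norming integral at `λ` is the Wronskian in `z` of `z a` and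
`b`, which reduces to `-λ a(λ) b'(λ)` when `b(λ) = 0` (`sum_norm_phiPlus_sq`,
`hasSpectralData_iff`). The theorem thus becomes a statement about pairs `(a, b)`.

Uniqueness. Nonzero norming constants make the zeros of `b` simple, so `σ` and `b(0) = 1` determine
`b`; the values `a(λ)` and `deg a < deg b` determine `a` (`HasSpectralData.unique`). The masses are
then recovered from left to right (`jost_injective`): the leftmost position is the only `y` at which
`z a + e^{-y} b` drops in degree, and its strength is the polynomial part of `a` divided by that
combination.

Existence. Interpolation gives `a / b = ∑ r_λ / (λ - z)`, and `λ γ_λ² > 0` says exactly that every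
`r_λ > 0`. Equivalently, the Bezoutian of `a` and `b` is positive definite
(`bezoutPos_spectralPoly`). Stripping off the leftmost mass changes the Bezoutian by a positive
factor and by squares; the negative ones are avoided by restricting to functionals that annihilate
them, at the price of a lower degree. Positivity therefore survives, and it forces nonnegative
dipoles and increasing positions, so the pair is dismantled completely (`IsJostPair.exists_jost`).
-/

noncomputable section

namespace GeneralizedSpectralProblem

open Polynomial

/-! ### Transfer polynomials of a chain of point masses -/

/-- A point of the support of a discrete pair, with its masses in `ω` and in `υ`. -/
structure PointMass where
  pos : ℝ
  weight : ℝ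
  dipole : ℝ

/-- The points are listed from left to right, with masses as in `IsDiscretePair`. -/
def Admissible (L : List PointMass) : Prop :=
  L.Pairwise (fun p q => p.pos < q.pos) ∧ ∀ p ∈ L, 0 ≤ p.dipole ∧ 0 < |p.weight| + p.dipole

/-- The polynomial `ωₙ + υₙ z`. -/
def PointMass.strength (p : PointMass) : ℝ[X] := C p.weight + C p.dipole * X

/-- Polynomials `(a, b)` such that `φ₊(z, x) = z a(z) exp (x / 2) + b(z) exp (-x / 2)` to the left
of all point masses. -/
def jost : List PointMass → ℝ[X] × ℝ[X]
  | [] => (0, 1)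
  | p :: L =>
    ((jost L).1 + p.strength * (X * (jost L).1 + C (Real.exp (-p.pos)) * (jost L).2),
      (jost L).2 - C (Real.exp p.pos) * (X * p.strength *
        (X * (jost L).1 + C (Real.exp (-p.pos)) * (jost L).2)))

/-- The polynomial with `φ₊(z, y) = exp (y / 2) * siteValue y L z`
for `y` to the left of all point masses. -/
def siteValue (y : ℝ) (L : List PointMass) : ℝ[X] :=
  X * (jost L).1 + C (Real.exp (-y)) * (jost L).2

lemma jost_cons_fst (p : PointMass) (L : List PointMass) :
    (jost (p :: L)).1 = (jost L).1 + p.strength * siteValue p.pos L := rfl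

lemma jost_cons_snd (p : PointMass) (L : List PointMass) :
    (jost (p :: L)).2 =
      (jost L).2 - C (Real.exp p.pos) * (X * p.strength * siteValue p.pos L) := rfl

/-- This is continuity of `φ₊` at the new mass: the increments of the two coefficients cancel at its
position. -/
lemma siteValue_cons (p : PointMass) (L : List PointMass) :
    siteValue p.pos (p :: L) = siteValue p.pos L := by
  have h : C (Real.exp (-p.pos)) * C (Real.exp p.pos) = (1 : ℝ[X]) := by
    rw [← C_mul, ← Real.exp_add]; simp
  rw [siteValue, jost_cons_fst, jost_cons_snd]
  conv_rhs => rw [siteValue]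
  linear_combination (-(X * p.strength * siteValue p.pos L)) * h

lemma jost_snd_eval_zero (L : List PointMass) : (jost L).2.eval 0 = 1 := by
  induction L with
  | nil => simp [jost]
  | cons p L ih => simp [jost_cons_snd, ih]

lemma jost_snd_ne_zero (L : List PointMass) : (jost L).2 ≠ 0 := fun h => by
  simpa [h] using jost_snd_eval_zero L

lemma Admissible.tail {p : PointMass} {L : List PointMass} (h : Admissible (p :: L)) :
    Admissible L :=
  ⟨(List.pairwise_cons.1 h.1).2, fun q hq => h.2 q (List.mem_cons_of_mem _ hq)⟩

lemma Admissible.lt {p : PointMass} {L : List PointMass} (h : Admissible (p :: L)) :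
    ∀ q ∈ L, p.pos < q.pos :=
  (List.pairwise_cons.1 h.1).1

lemma PointMass.strength_ne_zero {p : PointMass} (h : 0 < |p.weight| + p.dipole) :
    p.strength ≠ 0 := fun h0 => by
  have hw : p.weight = 0 := by simpa [strength] using congrArg (coeff · 0) h0
  have hv : p.dipole = 0 := by simpa [strength] using congrArg (coeff · 1) h0
  simp [hw, hv] at h

/-! ### Degrees, and recovering the masses from the polynomials -/

lemma degree_lt_of_degree_X_mul_le {P Q : ℝ[X]} (hQ : Q ≠ 0) (h : (X * P).degree ≤ Q.degree) :
    P.degree < Q.degree := by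
  rcases eq_or_ne P 0 with rfl | hP
  · simpa [bot_lt_iff_ne_bot] using hQ
  · refine lt_of_lt_of_le ?_ h
    rw [mul_comm]
    exact degree_lt_degree_mul_X hP

/-- The new mass leaves the value at its own position unchanged but adds to `b` a multiple of `X *
p.strength` times that value, which has strictly larger degree and so dominates. -/
lemma degree_siteValue_lt_degree_jost_cons {p : PointMass} {L : List PointMass}
    (hq : p.strength ≠ 0) (hg : (siteValue p.pos L).degree = (jost L).2.degree) :
    (siteValue p.pos (p :: L)).degree < (jost (p :: L)).2.degree := by
  rw [siteValue_cons]
  have hg0 : siteValue p.pos L ≠ 0 := by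
    rw [← degree_ne_bot, hg, degree_ne_bot]; exact jost_snd_ne_zero L
  have hlt : (siteValue p.pos L).degree <
      (C (Real.exp p.pos) * (X * p.strength * siteValue p.pos L)).degree := by
    rw [degree_C_mul (Real.exp_pos _).ne', mul_assoc, mul_left_comm, ← mul_assoc]
    refine lt_of_lt_of_le (degree_lt_degree_mul_X hg0) ?_
    rw [mul_assoc, mul_comm X]
    exact degree_le_mul_left _ hq |>.trans (by rw [mul_comm])
  rw [jost_cons_snd, degree_sub_eq_right_of_degree_lt (by rwa [← hg])]
  exact hlt

/-- Moving from the leftmost mass to a smaller `y` adds a nonzero multiple of `b` to a polynomial of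
lower degree; this supplies the hypothesis for attaching the next mass. -/
lemma degree_jost {L : List PointMass} (hL : Admissible L) :
    (jost L).1.degree < (jost L).2.degree ∧
      ∀ y, (∀ p ∈ L, y < p.pos) → (siteValue y L).degree = (jost L).2.degree := by
  induction L with
  | nil => simp [jost, siteValue, degree_C (Real.exp_pos _).ne']
  | cons p L ih =>
    have hlt := degree_siteValue_lt_degree_jost_cons
      (PointMass.strength_ne_zero (hL.2 p (by simp)).2) ((ih hL.tail).2 p.pos hL.lt)
    refine ⟨degree_lt_of_degree_X_mul_le (jost_snd_ne_zero _) ?_, fun y hy => ?_⟩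
    · have : X * (jost (p :: L)).1 =
          siteValue p.pos (p :: L) - C (Real.exp (-p.pos)) * (jost (p :: L)).2 := by
        rw [siteValue]; ring
      rw [this]
      refine (degree_sub_le _ _).trans (max_le hlt.le ?_)
      rw [degree_C_mul (Real.exp_pos _).ne']
    · have hy' : Real.exp (-y) - Real.exp (-p.pos) ≠ 0 := by
        rw [sub_ne_zero, ne_eq, Real.exp_eq_exp]
        have := hy p (by simp)
        intro h; linarith
      have : siteValue y (p :: L) = siteValue p.pos (p :: L) +
          C (Real.exp (-y) - Real.exp (-p.pos)) * (jost (p :: L)).2 := by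
        rw [siteValue, siteValue, C_sub]; ring
      rw [this, degree_add_eq_right_of_degree_lt, degree_C_mul hy']
      rwa [degree_C_mul hy']

lemma degree_siteValue_head_lt {p : PointMass} {L : List PointMass} (hL : Admissible (p :: L)) :
    (siteValue p.pos (p :: L)).degree < (jost (p :: L)).2.degree :=
  degree_siteValue_lt_degree_jost_cons (PointMass.strength_ne_zero (hL.2 p (by simp)).2)
    ((degree_jost hL.tail).2 p.pos hL.lt)

lemma jost_cons_ne_jost_nil {p : PointMass} {L : List PointMass} (hL : Admissible (p :: L)) :
    jost (p :: L) ≠ jost [] := fun h => by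
  have h1 := degree_siteValue_head_lt hL
  rw [siteValue, h] at h1
  simp [jost, degree_C (Real.exp_pos _).ne'] at h1

/-- One step of the inverse problem: the degree drop locates the leftmost mass, and uniqueness of
division with remainder gives its strength. -/
lemma jost_cons_tail_eq {p : PointMass} {L L' : List PointMass} {p' : PointMass}
    (hL : Admissible (p :: L)) (hL' : Admissible (p' :: L'))
    (h : jost (p :: L) = jost (p' :: L')) : p = p' ∧ jost L = jost L' := by
  have hpos : p.pos = p'.pos := by
    by_contra hne
    have hne' : Real.exp (-p.pos) - Real.exp (-p'.pos) ≠ 0 := by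
      rw [sub_ne_zero, ne_eq, Real.exp_eq_exp, neg_inj]; exact hne
    have h1 := degree_siteValue_head_lt hL
    have h2 := degree_siteValue_head_lt hL'
    rw [← h] at h2
    -- If the degree dropped at two positions, the difference, a nonzero multiple of `b`, would have
    -- degree below that of `b`.
    have h3 : C (Real.exp (-p.pos) - Real.exp (-p'.pos)) * (jost (p :: L)).2 =
        siteValue p.pos (p :: L) - siteValue p'.pos (p' :: L') := by
      rw [siteValue, siteValue, ← h, C_sub]; ring
    have h4 := (degree_sub_le _ _).trans_lt (max_lt h1 h2)
    rw [← h3, degree_C_mul hne'] at h4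
    exact lt_irrefl _ h4
  have hg : siteValue p.pos L = siteValue p'.pos L' := by
    rw [← siteValue_cons, ← siteValue_cons p', siteValue, siteValue, h, hpos]
  have h1 := degree_jost hL.tail
  have h2 := degree_jost hL'.tail
  have e1 := h1.2 _ hL.lt
  have e2 := h2.2 _ hL'.lt
  have hd : (p.strength - p'.strength) * siteValue p.pos L = (jost L').1 - (jost L).1 := by
    have := congrArg Prod.fst h
    rw [jost_cons_fst, jost_cons_fst, ← hg] at this
    linear_combination this
  -- Both remaining first components have degree below the common divisor, so the two quotients
  -- agree.
  have hq : p.strength - p'.strength = 0 := by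
    by_contra hne
    have h3 : ((jost L').1 - (jost L).1).degree < (siteValue p.pos L).degree :=
      (degree_sub_le _ _).trans_lt
        (max_lt (by rw [hg, e2]; exact h2.1) (by rw [e1]; exact h1.1))
    rw [← hd] at h3
    exact absurd (degree_le_mul_left _ hne) (by rw [mul_comm]; exact not_le.2 h3)
  have hq' := sub_eq_zero.1 hq
  have hw : p.weight = p'.weight := by
    simpa [PointMass.strength] using congrArg (coeff · 0) hq'
  have hv : p.dipole = p'.dipole := by
    simpa [PointMass.strength] using congrArg (coeff · 1) hq'
  refine ⟨by cases p; cases p'; simp_all, Prod.ext ?_ ?_⟩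
  · rw [hq, zero_mul] at hd
    exact (sub_eq_zero.1 hd.symm).symm
  · have := congrArg Prod.snd h
    rw [jost_cons_snd, jost_cons_snd, ← hg, ← hq', ← hpos] at this
    linear_combination this

theorem jost_injective {L L' : List PointMass} (hL : Admissible L) (hL' : Admissible L')
    (h : jost L = jost L') : L = L' := by
  induction L generalizing L' with
  | nil =>
    cases L' with
    | nil => rfl
    | cons p' L' => exact absurd h.symm (jost_cons_ne_jost_nil hL')
  | cons p L ih =>
    cases L' with
    | nil => exact absurd h (jost_cons_ne_jost_nil hL)
    | cons p' L' =>
      obtain ⟨hp, hj⟩ := jost_cons_tail_eq hL hL' h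
      rw [hp, ih hL.tail hL'.tail hj]

/-! ### The Wronskian in the spectral parameter -/

/-- The Wronskian of `z a(z)` and `b(z)`, where `(a, b) = jost L`. -/
def jostWronskian (L : List PointMass) : ℝ[X] :=
  derivative (X * (jost L).1) * (jost L).2 - X * (jost L).1 * derivative (jost L).2

/-- The derivative of `X * p.strength` is `weight + 2 * dipole * X`, so the increment is the
contribution of the new mass to the norming integral. -/
lemma jostWronskian_cons (p : PointMass) (L : List PointMass) :
    jostWronskian (p :: L) = jostWronskian L +
      C (Real.exp p.pos) * derivative (X * p.strength) * siteValue p.pos L ^ 2 := by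
  have h : C (Real.exp (-p.pos)) * C (Real.exp p.pos) = (1 : ℝ[X]) := by
    rw [← C_mul, ← Real.exp_add]; simp
  have hB : (jost L).2 = C (Real.exp p.pos) * (siteValue p.pos L - X * (jost L).1) := by
    rw [siteValue]; linear_combination (-(jost L).2) * h
  rw [jostWronskian, jostWronskian, jost_cons_fst, jost_cons_snd]
  generalize siteValue p.pos L = g at *
  generalize p.strength = q at *
  rw [hB]
  simp only [derivative_mul, derivative_add, derivative_sub, derivative_X, derivative_C]
  ring

/-! ### Bezoutian forms -/

/-- Coefficients of the Bezoutian `(P(x) Q(y) - Q(x) P(y)) / (x - y)`. -/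
def bezoutCoeff (P Q : ℝ[X]) (i j : ℕ) : ℝ :=
  ∑ k ∈ Finset.range (i + 1),
    (P.coeff (j + 1 + k) * Q.coeff (i - k) - Q.coeff (j + 1 + k) * P.coeff (i - k))

/-- The quadratic form of the Bezoutian, truncated to size `n`. -/
def bezoutForm (n : ℕ) (P Q : ℝ[X]) (l : ℕ → ℝ) : ℝ :=
  ∑ i ∈ Finset.range n, ∑ j ∈ Finset.range n, bezoutCoeff P Q i j * (l i * l j)

/-- The linear functional `X ^ i ↦ l i`, truncated to degree less than `n`. -/
def coeffPairing (n : ℕ) (l : ℕ → ℝ) (P : ℝ[X]) : ℝ :=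
  ∑ i ∈ Finset.range n, l i * P.coeff i

lemma bezoutCoeff_add_left (P P' Q : ℝ[X]) (i j : ℕ) :
    bezoutCoeff (P + P') Q i j = bezoutCoeff P Q i j + bezoutCoeff P' Q i j := by
  rw [bezoutCoeff, bezoutCoeff, bezoutCoeff, ← Finset.sum_add_distrib]
  refine Finset.sum_congr rfl fun k _ => ?_
  simp only [coeff_add]; ring

lemma bezoutCoeff_C_mul_left (c : ℝ) (P Q : ℝ[X]) (i j : ℕ) :
    bezoutCoeff (C c * P) Q i j = c * bezoutCoeff P Q i j := by
  rw [bezoutCoeff, bezoutCoeff, Finset.mul_sum]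
  refine Finset.sum_congr rfl fun k _ => ?_
  simp only [coeff_C_mul]; ring

lemma bezoutCoeff_swap (P Q : ℝ[X]) (i j : ℕ) : bezoutCoeff Q P i j = -bezoutCoeff P Q i j := by
  rw [bezoutCoeff, bezoutCoeff, ← Finset.sum_neg_distrib]
  refine Finset.sum_congr rfl fun k _ => ?_
  ring

/-- The Bezoutian of `X * Q` and `Q` is `Q(x) Q(y)`; the defining sum telescopes. This is the source
of all squares below. -/
lemma bezoutCoeff_X_mul_self (Q : ℝ[X]) (i j : ℕ) :
    bezoutCoeff (X * Q) Q i j = Q.coeff i * Q.coeff j := by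
  have h : ∀ k ∈ Finset.range (i + 1),
      (X * Q).coeff (j + 1 + k) * Q.coeff (i - k) - Q.coeff (j + 1 + k) * (X * Q).coeff (i - k) =
      Q.coeff (j + k) * (X * Q).coeff (i + 1 - k) -
        Q.coeff (j + (k + 1)) * (X * Q).coeff (i + 1 - (k + 1)) := by
    intro k hk
    have hk' : k ≤ i := Nat.lt_succ_iff.1 (Finset.mem_range.1 hk)
    rw [show j + 1 + k = (j + k) + 1 by ring, coeff_X_mul,
      show i + 1 - k = (i - k) + 1 by omega, coeff_X_mul, Nat.add_sub_add_right]
    rfl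
  have h2 := Finset.sum_range_sub' (fun k => Q.coeff (j + k) * (X * Q).coeff (i + 1 - k)) (i + 1)
  rw [bezoutCoeff, Finset.sum_congr rfl h]
  refine h2.trans ?_
  simp [mul_comm]

lemma bezoutCoeff_eq_zero_right {P Q : ℝ[X]} {n : ℕ} (hP : P.natDegree ≤ n) (hQ : Q.natDegree ≤ n)
    (i : ℕ) {j : ℕ} (hj : n ≤ j) : bezoutCoeff P Q i j = 0 := by
  refine Finset.sum_eq_zero fun k _ => ?_
  rw [coeff_eq_zero_of_natDegree_lt (show P.natDegree < j + 1 + k by omega),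
    coeff_eq_zero_of_natDegree_lt (show Q.natDegree < j + 1 + k by omega)]
  simp

lemma bezoutCoeff_eq_zero_left {P Q : ℝ[X]} {n : ℕ} (hP : P.natDegree ≤ n) (hQ : Q.natDegree ≤ n)
    {i : ℕ} (j : ℕ) (hi : n ≤ i) : bezoutCoeff P Q i j = 0 := by
  rcases le_or_gt i j with hij | hij
  · exact bezoutCoeff_eq_zero_right hP hQ i (hi.trans hij)
  obtain ⟨m, rfl⟩ := Nat.exists_eq_add_of_lt hij
  -- With `i = j + m + 1`, the first `m + 1` terms are antisymmetric under `k ↦ m - k` and cancel;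
  -- the others involve coefficients of index above `i ≥ n`.
  rw [bezoutCoeff, show j + m + 1 + 1 = (m + 1) + (j + 1) by ring, Finset.sum_range_add]
  have h2 : ∀ k ∈ Finset.range (j + 1),
      P.coeff (j + 1 + (m + 1 + k)) * Q.coeff (j + m + 1 - (m + 1 + k)) -
        Q.coeff (j + 1 + (m + 1 + k)) * P.coeff (j + m + 1 - (m + 1 + k)) = 0 := by
    intro k _
    rw [coeff_eq_zero_of_natDegree_lt (show P.natDegree < j + 1 + (m + 1 + k) by omega),
      coeff_eq_zero_of_natDegree_lt (show Q.natDegree < j + 1 + (m + 1 + k) by omega)]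
    simp
  rw [Finset.sum_eq_zero h2, add_zero]
  have h3 := Finset.sum_range_reflect (fun k => P.coeff (j + 1 + k) * Q.coeff (j + m + 1 - k) -
    Q.coeff (j + 1 + k) * P.coeff (j + m + 1 - k)) (m + 1)
  have h4 : ∀ k ∈ Finset.range (m + 1),
      P.coeff (j + 1 + (m + 1 - 1 - k)) * Q.coeff (j + m + 1 - (m + 1 - 1 - k)) -
        Q.coeff (j + 1 + (m + 1 - 1 - k)) * P.coeff (j + m + 1 - (m + 1 - 1 - k)) =
      -(P.coeff (j + 1 + k) * Q.coeff (j + m + 1 - k) -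
        Q.coeff (j + 1 + k) * P.coeff (j + m + 1 - k)) := by
    intro k hk
    have hk' := Finset.mem_range.1 hk
    rw [show j + 1 + (m + 1 - 1 - k) = j + m + 1 - k by omega,
      show j + m + 1 - (m + 1 - 1 - k) = j + 1 + k by omega]
    ring
  rw [Finset.sum_congr rfl h4, Finset.sum_neg_distrib] at h3
  linarith

lemma bezoutForm_add_left (n : ℕ) (P P' Q : ℝ[X]) (l : ℕ → ℝ) :
    bezoutForm n (P + P') Q l = bezoutForm n P Q l + bezoutForm n P' Q l := by
  simp only [bezoutForm, bezoutCoeff_add_left, add_mul, Finset.sum_add_distrib]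

lemma bezoutForm_C_mul_left (n : ℕ) (c : ℝ) (P Q : ℝ[X]) (l : ℕ → ℝ) :
    bezoutForm n (C c * P) Q l = c * bezoutForm n P Q l := by
  simp only [bezoutForm, bezoutCoeff_C_mul_left, Finset.mul_sum, mul_assoc]

lemma bezoutForm_swap (n : ℕ) (P Q : ℝ[X]) (l : ℕ → ℝ) :
    bezoutForm n Q P l = -bezoutForm n P Q l := by
  simp only [bezoutForm, bezoutCoeff_swap P Q, neg_mul, Finset.sum_neg_distrib]

lemma bezoutForm_self (n : ℕ) (P : ℝ[X]) (l : ℕ → ℝ) : bezoutForm n P P l = 0 := by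
  linarith [bezoutForm_swap n P P l]

lemma bezoutForm_sum_left {ι : Type*} (s : Finset ι) (n : ℕ) (P : ι → ℝ[X]) (Q : ℝ[X])
    (l : ℕ → ℝ) : bezoutForm n (∑ i ∈ s, P i) Q l = ∑ i ∈ s, bezoutForm n (P i) Q l := by
  classical
  induction s using Finset.induction_on with
  | empty => simpa using bezoutForm_C_mul_left n 0 0 Q l
  | insert a s ha ih => rw [Finset.sum_insert ha, bezoutForm_add_left, ih, Finset.sum_insert ha]

lemma bezoutForm_add_right (n : ℕ) (P Q Q' : ℝ[X]) (l : ℕ → ℝ) :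
    bezoutForm n P (Q + Q') l = bezoutForm n P Q l + bezoutForm n P Q' l := by
  rw [← neg_inj, ← bezoutForm_swap, bezoutForm_add_left, bezoutForm_swap n P, bezoutForm_swap n P,
    neg_add]

lemma bezoutForm_C_mul_right (n : ℕ) (c : ℝ) (P Q : ℝ[X]) (l : ℕ → ℝ) :
    bezoutForm n P (C c * Q) l = c * bezoutForm n P Q l := by
  rw [← neg_inj, ← bezoutForm_swap, bezoutForm_C_mul_left, bezoutForm_swap n P, mul_neg]

lemma bezoutForm_X_mul_self (n : ℕ) (Q : ℝ[X]) (l : ℕ → ℝ) :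
    bezoutForm n (X * Q) Q l = coeffPairing n l Q ^ 2 := by
  rw [bezoutForm, coeffPairing, sq, Finset.sum_mul_sum]
  refine Finset.sum_congr rfl fun i _ => Finset.sum_congr rfl fun j _ => ?_
  rw [bezoutCoeff_X_mul_self]; ring

lemma bezoutForm_self_X_mul (n : ℕ) (Q : ℝ[X]) (l : ℕ → ℝ) :
    bezoutForm n Q (X * Q) l = -coeffPairing n l Q ^ 2 := by
  rw [bezoutForm_swap, bezoutForm_X_mul_self]

lemma bezoutForm_succ {P Q : ℝ[X]} {n : ℕ} (hP : P.natDegree ≤ n) (hQ : Q.natDegree ≤ n)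
    (l : ℕ → ℝ) : bezoutForm (n + 1) P Q l = bezoutForm n P Q l := by
  rw [bezoutForm, Finset.sum_range_succ, bezoutForm]
  rw [Finset.sum_eq_zero (s := Finset.range (n + 1)) (f := fun j => bezoutCoeff P Q n j * _)
    fun j _ => by rw [bezoutCoeff_eq_zero_left hP hQ j le_rfl, zero_mul], add_zero]
  refine Finset.sum_congr rfl fun i _ => ?_
  rw [Finset.sum_range_succ, bezoutCoeff_eq_zero_right hP hQ i le_rfl, zero_mul, add_zero]

lemma bezoutForm_congr {P Q : ℝ[X]} {n : ℕ} {l l' : ℕ → ℝ} (h : ∀ i < n, l i = l' i) :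
    bezoutForm n P Q l = bezoutForm n P Q l' := by
  refine Finset.sum_congr rfl fun i hi => Finset.sum_congr rfl fun j hj => ?_
  rw [h i (Finset.mem_range.1 hi), h j (Finset.mem_range.1 hj)]

/-- The Bezoutian of `P` and `Q` is positive definite on functionals on degree less than `n`. -/
def BezoutPos (n : ℕ) (P Q : ℝ[X]) : Prop :=
  ∀ l : ℕ → ℝ, (∃ i < n, l i ≠ 0) → 0 < bezoutForm n P Q l

/-- Testing on the last coordinate functional isolates the corner entry. It controls the signs of
the leading coefficients. -/
lemma BezoutPos.coeff_pos {n : ℕ} {P Q : ℝ[X]} (h : BezoutPos (n + 1) P Q)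
    (hP : P.natDegree ≤ n + 1) (hQ : Q.natDegree ≤ n + 1) :
    0 < P.coeff (n + 1) * Q.coeff n - Q.coeff (n + 1) * P.coeff n := by
  have h1 := h (fun i => if i = n then 1 else 0) ⟨n, by simp⟩
  have h2 : bezoutCoeff P Q n n =
      P.coeff (n + 1) * Q.coeff n - Q.coeff (n + 1) * P.coeff n := by
    rw [bezoutCoeff, Finset.sum_range_succ', Finset.sum_eq_zero, zero_add]
    · simp
    · intro k _
      rw [coeff_eq_zero_of_natDegree_lt (show P.natDegree < n + 1 + (k + 1) by omega),
        coeff_eq_zero_of_natDegree_lt (show Q.natDegree < n + 1 + (k + 1) by omega)]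
      simp
  rw [← h2]
  simpa [bezoutForm] using h1

/-- Restricting to the functionals that annihilate a polynomial `R` of degree exactly `n`. -/
lemma exists_extension {n : ℕ} {R : ℝ[X]} (hR : R.coeff n ≠ 0) (l : ℕ → ℝ) :
    ∃ l' : ℕ → ℝ, (∀ i < n, l' i = l i) ∧ coeffPairing (n + 1) l' R = 0 := by
  refine ⟨fun i => if i < n then l i else -coeffPairing n l R / R.coeff n,
    fun i hi => by simp [hi], ?_⟩
  rw [coeffPairing, Finset.sum_range_succ]
  have : ∑ i ∈ Finset.range n, (if i < n then l i else -coeffPairing n l R / R.coeff n) *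
      R.coeff i = coeffPairing n l R := by
    refine Finset.sum_congr rfl fun i hi => ?_
    rw [if_pos (Finset.mem_range.1 hi)]
  rw [this]
  simp only [lt_irrefl, if_false]
  field_simp
  ring

/-- If the Bezoutian of `P, Q` is that of `P', Q'` up to a positive factor and a multiple of
`R ⊗ R`, and `P', Q'` have smaller degree, then positivity is inherited. -/
lemma BezoutPos.of_perturb {n : ℕ} {P Q P' Q' R : ℝ[X]} (h : BezoutPos (n + 1) P Q)
    (hR : R.coeff n ≠ 0) (hP' : P'.natDegree ≤ n) (hQ' : Q'.natDegree ≤ n) {c d : ℝ} (hc : 0 < c)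
    (hform : ∀ l, bezoutForm (n + 1) P' Q' l =
      c * bezoutForm (n + 1) P Q l + d * coeffPairing (n + 1) l R ^ 2) : BezoutPos n P' Q' := by
  rintro l ⟨i, hi, hli⟩
  obtain ⟨l', hl', h0⟩ := exists_extension hR l
  rw [bezoutForm_congr fun i hi => (hl' i hi).symm, ← bezoutForm_succ hP' hQ', hform, h0]
  have := h l' ⟨i, by omega, by rwa [hl' i hi]⟩
  simpa using mul_pos hc this

lemma natDegree_le_of_coeff_eq_zero {P : ℝ[X]} {n : ℕ} (h : ∀ i, n < i → P.coeff i = 0) :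
    P.natDegree ≤ n :=
  natDegree_le_iff_coeff_eq_zero.2 fun i hi => h i hi

/-! ### Stripping off the leftmost mass -/

/-- The pair `(A, B)` has size `n` and satisfies the positivity that characterizes `jost`. -/
structure IsJostPair (n : ℕ) (A B : ℝ[X]) : Prop where
  coeff_fst : ∀ i, n ≤ i → A.coeff i = 0
  natDegree_snd : B.natDegree ≤ n
  eval_zero : B.eval 0 = 1
  bezoutPos : BezoutPos n A B

lemma IsJostPair.coeff_mul_neg {n : ℕ} {A B : ℝ[X]} (h : IsJostPair (n + 1) A B) :
    B.coeff (n + 1) * A.coeff n < 0 := by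
  have h1 := h.bezoutPos.coeff_pos
    (natDegree_le_of_coeff_eq_zero fun i hi => h.coeff_fst i hi.le) h.natDegree_snd
  rw [h.coeff_fst (n + 1) le_rfl] at h1
  linarith

/-- Removing the leftmost point: the sum of the remaining coefficients. -/
lemma IsJostPair.exists_strength {n : ℕ} {A g : ℝ[X]} {s : ℝ} (hs : 0 < s)
    (hA : ∀ i, n + 1 ≤ i → A.coeff i = 0) (hAn : A.coeff n ≠ 0) (hg : g.natDegree ≤ n)
    (hg0 : g.eval 0 = s) (hpos : BezoutPos n A g) :
    ∃ (m : ℕ) (α β : ℝ), m ≤ n ∧ 0 ≤ β ∧ 0 < |α| + β ∧ g.natDegree ≤ m ∧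
      (∀ i, m ≤ i → (A - (C α + C β * X) * g).coeff i = 0) ∧
      BezoutPos m (A - (C α + C β * X) * g) g := by
  have hcoef : ∀ (α β : ℝ) (i : ℕ), (A - (C α + C β * X) * g).coeff i =
      A.coeff i - (α * g.coeff i + β * (X * g).coeff i) := by
    intro α β i
    rw [add_mul, mul_assoc, coeff_sub, coeff_add, coeff_C_mul, coeff_C_mul]
  have hform : ∀ (m : ℕ) (α β : ℝ) (l : ℕ → ℝ), bezoutForm m (A - (C α + C β * X) * g) g l =
      bezoutForm m A g l - β * coeffPairing m l g ^ 2 := by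
    intro m α β l
    have : A - (C α + C β * X) * g = A + (C (-α) * g + C (-β) * (X * g)) := by
      simp only [C_neg]; ring
    rw [this, bezoutForm_add_left, bezoutForm_add_left, bezoutForm_C_mul_left,
      bezoutForm_C_mul_left, bezoutForm_self, bezoutForm_X_mul_self]
    ring
  have hgi : ∀ i, n < i → g.coeff i = 0 := fun i hi =>
    coeff_eq_zero_of_natDegree_lt (hg.trans_lt hi)
  -- The degree of `g` decides whether the quotient `α + β X` of `A` by `g` has degree one (a dipole
  -- is present) or zero.
  by_cases hgn : g.coeff n = 0
  · rcases n with _ | k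
    · rw [← coeff_zero_eq_eval_zero] at hg0
      exact absurd (hg0.symm.trans hgn) hs.ne'
    have h1 := hpos.coeff_pos
      (natDegree_le_of_coeff_eq_zero fun i hi => hA i hi) hg
    -- The corner entry shows that `g` has degree exactly `k` and that its leading coefficient has
    -- the sign of that of `A`, hence `β > 0`.
    rw [hgn, zero_mul, sub_zero] at h1
    have hgk : g.coeff k ≠ 0 := right_ne_zero_of_mul h1.ne'
    have hβ : 0 < A.coeff (k + 1) / g.coeff k := by
      rcases pos_and_pos_or_neg_and_neg_of_mul_pos h1 with ⟨h, h'⟩ | ⟨h, h'⟩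
      · exact div_pos h h'
      · exact div_pos_of_neg_of_neg h h'
    have hgk' : ∀ i, k < i → g.coeff i = 0 := by
      intro i hi
      rcases eq_or_lt_of_le (Nat.succ_le_of_lt hi) with rfl | h
      · exact hgn
      · exact hgi i h
    have hdeg : g.natDegree ≤ k := natDegree_le_of_coeff_eq_zero hgk'
    set β := A.coeff (k + 1) / g.coeff k with hβdef
    set α := (A.coeff k - β * (X * g).coeff k) / g.coeff k with hαdef
    have hcz : ∀ i, k ≤ i → (A - (C α + C β * X) * g).coeff i = 0 := by
      intro i hi
      rw [hcoef]
      rcases eq_or_lt_of_le hi with rfl | h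
      · rw [hαdef]; field_simp; ring
      · rw [hgk' i h]
        obtain ⟨j, rfl⟩ := Nat.exists_eq_add_of_lt h
        rw [coeff_X_mul]
        rcases j with _ | j
        · simp only [add_zero]
          rw [hβdef]; field_simp; ring
        · rw [hA _ (by omega), hgk' _ (by omega)]; ring
    refine ⟨k, α, β, by omega, hβ.le, by positivity, hdeg, hcz, ?_⟩
    -- The form loses `β` times the square of the pairing with `g`, so it is tested only on
    -- functionals that annihilate `g`; this is what lowers the size to `k`.
    refine hpos.of_perturb hgk (natDegree_le_of_coeff_eq_zero fun i hi => hcz i hi.le) hdeg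
      one_pos (d := -β) fun l => ?_
    rw [hform]; ring
  -- Here `β = 0`: subtracting a constant multiple of `g` leaves the Bezoutian with `g` unchanged,
  -- and the size stays `n`.
  · refine ⟨n, A.coeff n / g.coeff n, 0, le_rfl, le_rfl, ?_, hg, ?_, ?_⟩
    · rw [add_zero]; exact abs_pos.2 (div_ne_zero hAn hgn)
    · intro i hi
      rw [hcoef]
      rcases eq_or_lt_of_le hi with rfl | h
      · field_simp; ring
      · rw [hA i h, hgi i h]; ring
    · intro l hl
      rw [hform, zero_mul, sub_zero]
      exact hpos l hl

/-- Strong induction on the size, which drops by one, or by two when a dipole is removed. The last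
clause carries the ordering: for `n > 0` it bounds each `e^{-p.pos}` by the ratio `-A.coeff (n - 1)
/ B.coeff n`, which is the value for the leftmost mass. For `n = 0` the list is empty, so the
truncated `n - 1` is harmless. -/
theorem IsJostPair.exists_jost {n : ℕ} {A B : ℝ[X]} (h : IsJostPair n A B) :
    ∃ L, Admissible L ∧ jost L = (A, B) ∧
      ∀ p ∈ L, Real.exp (-p.pos) * B.coeff n ^ 2 ≤ -A.coeff (n - 1) * B.coeff n := by
  induction n using Nat.strong_induction_on generalizing A B with
  | _ n ih =>
  rcases n with _ | n
  · refine ⟨[], ⟨List.Pairwise.nil, by simp⟩, ?_, by simp⟩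
    have hA : A = 0 := by ext i; simpa using h.coeff_fst i (Nat.zero_le i)
    have hB := eq_C_of_natDegree_le_zero h.natDegree_snd
    rw [coeff_zero_eq_eval_zero, h.eval_zero, C_1] at hB
    rw [hA, hB]; rfl
  have hneg := h.coeff_mul_neg
  have hb : B.coeff (n + 1) ≠ 0 := left_ne_zero_of_mul hneg.ne
  have ha : A.coeff n ≠ 0 := right_ne_zero_of_mul hneg.ne
  -- `s = e^{-x₁}` is the only value for which the top coefficient of `X * A + s * B` cancels.
  obtain ⟨s, hsdef⟩ : ∃ s, s = -A.coeff n / B.coeff (n + 1) := ⟨_, rfl⟩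
  have hs : 0 < s := by
    have : s = -(B.coeff (n + 1) * A.coeff n) / B.coeff (n + 1) ^ 2 := by
      rw [hsdef]; field_simp
    rw [this]; exact div_pos (by linarith) (by positivity)
  have hsb : s * B.coeff (n + 1) = -A.coeff n := by rw [hsdef]; field_simp
  obtain ⟨g, hgdef⟩ : ∃ g, g = X * A + C s * B := ⟨_, rfl⟩
  have hAdeg : A.natDegree ≤ n := natDegree_le_of_coeff_eq_zero fun i hi => h.coeff_fst i hi
  have hg : g.natDegree ≤ n := by
    refine natDegree_le_of_coeff_eq_zero fun i hi => ?_
    obtain ⟨j, rfl⟩ := Nat.exists_eq_add_of_lt hi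
    rw [hgdef, coeff_add, coeff_X_mul, coeff_C_mul]
    rcases j with _ | j
    · rw [add_zero, hsb]; ring
    · rw [h.coeff_fst _ (by omega),
        coeff_eq_zero_of_natDegree_lt (h.natDegree_snd.trans_lt (by omega))]
      ring
  have hg0 : g.eval 0 = s := by simp [hgdef, h.eval_zero]
  have hpos : BezoutPos n A g := by
    -- Replacing `B` by `g` subtracts the square of the pairing with `A`, which has degree exactly
    -- `n`; functionals annihilating `A` do not see it.
    refine h.bezoutPos.of_perturb ha hAdeg hg hs (d := -1) fun l => ?_
    rw [hgdef, bezoutForm_add_right, bezoutForm_C_mul_right, bezoutForm_self_X_mul]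
    ring
  obtain ⟨m, α, β, hmn, hβ, hαβ, hgm, hA1, hpos1⟩ :=
    IsJostPair.exists_strength hs h.coeff_fst ha hg hg0 hpos
  obtain ⟨A₁, hA₁⟩ : ∃ A₁, A₁ = A - (C α + C β * X) * g := ⟨_, rfl⟩
  rw [← hA₁] at hA1 hpos1
  -- `B₁` is forced by requiring the same value `g` at the position of the removed mass; this only
  -- adds a square to the form.
  obtain ⟨B₁, hB₁⟩ : ∃ B₁, B₁ = C s⁻¹ * (g - X * A₁) := ⟨_, rfl⟩
  have hCs : C s * C s⁻¹ = (1 : ℝ[X]) := by rw [← C_mul, mul_inv_cancel₀ hs.ne', C_1]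
  have h₁ : IsJostPair m A₁ B₁ := by
    refine ⟨hA1, natDegree_le_of_coeff_eq_zero fun i hi => ?_, ?_, fun l hl => ?_⟩
    · obtain ⟨j, rfl⟩ := Nat.exists_eq_add_of_lt hi
      rw [hB₁, coeff_C_mul, coeff_sub, coeff_X_mul, hA1 _ (by omega),
        coeff_eq_zero_of_natDegree_lt (hgm.trans_lt hi)]
      ring
    · simp [hB₁, hg0, hs.ne']
    · have : g - X * A₁ = g + C (-1) * (X * A₁) := by simp only [C_neg, C_1]; ring
      rw [hB₁, bezoutForm_C_mul_right, this, bezoutForm_add_right, bezoutForm_C_mul_right,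
        bezoutForm_self_X_mul]
      have := hpos1 l hl
      have h2 : 0 < bezoutForm m A₁ g l + -1 * -coeffPairing m l A₁ ^ 2 := by nlinarith
      exact mul_pos (inv_pos.2 hs) h2
  obtain ⟨L, hL, hjost, hbound⟩ := ih m (by omega) h₁
  have hexp : Real.exp (-(-Real.log s)) = s := by rw [neg_neg, Real.exp_log hs]
  have hexp' : Real.exp (-Real.log s) = s⁻¹ := by rw [Real.exp_neg, Real.exp_log hs]
  have hlt : ∀ p ∈ L, Real.exp (-p.pos) < s := by
    intro p hp
    have hp' := hbound p hp
    -- The ratio that bounds the later `e^{-p.pos}` is strictly below `s`, so the removed mass lies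
    -- strictly to the left.
    have key : -A₁.coeff (m - 1) * B₁.coeff m < s * B₁.coeff m ^ 2 := by
      rcases m with _ | k
      · have : B₁.coeff 0 = 1 := by rw [coeff_zero_eq_eval_zero, h₁.eval_zero]
        rw [hA1 _ (Nat.zero_le _), this]; linarith
      · have hk := hpos1.coeff_pos
          (natDegree_le_of_coeff_eq_zero fun i hi => hA1 i hi.le) hgm
        rw [hA1 _ le_rfl, zero_mul, zero_sub] at hk
        have e : s * B₁.coeff (k + 1) = g.coeff (k + 1) - A₁.coeff k := by
          rw [hB₁, coeff_C_mul, coeff_sub, coeff_X_mul, mul_inv_cancel_left₀ hs.ne']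
        rw [Nat.add_sub_cancel]
        have h3 : s * (s * B₁.coeff (k + 1) ^ 2 - -A₁.coeff k * B₁.coeff (k + 1)) =
            g.coeff (k + 1) ^ 2 - g.coeff (k + 1) * A₁.coeff k := by
          linear_combination (s * B₁.coeff (k + 1) + g.coeff (k + 1)) * e
        have h4 : 0 < s * (s * B₁.coeff (k + 1) ^ 2 - -A₁.coeff k * B₁.coeff (k + 1)) := by
          rw [h3]; nlinarith
        have := pos_of_mul_pos_right h4 hs.le
        linarith
    exact lt_of_mul_lt_mul_right (hp'.trans_lt key) (sq_nonneg _)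
  have hsv : siteValue (-Real.log s) L = g := by
    rw [siteValue, hjost, hexp, hB₁]
    linear_combination (g - X * A₁) * hCs
  refine ⟨⟨-Real.log s, α, β⟩ :: L, ⟨List.pairwise_cons.2 ⟨fun p hp => ?_, hL.1⟩, ?_⟩, ?_, ?_⟩
  · have := hlt p hp
    rw [← hexp, Real.exp_lt_exp] at this
    show -Real.log s < p.pos
    linarith
  · intro p hp
    rcases List.mem_cons.1 hp with rfl | hp
    · exact ⟨hβ, hαβ⟩
    · exact hL.2 p hp
  · refine Prod.ext ?_ ?_
    · rw [jost_cons_fst, hjost, hsv]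
      simp only [PointMass.strength]
      rw [hA₁]; ring
    · rw [jost_cons_snd, hjost, hsv]
      simp only [PointMass.strength]
      rw [hexp', hB₁, hA₁]
      have : g - X * A = C s * B := by rw [hgdef]; ring
      linear_combination (C s⁻¹) * this + B * hCs
  · have hhead : s * B.coeff (n + 1) ^ 2 = -A.coeff n * B.coeff (n + 1) := by
      linear_combination B.coeff (n + 1) * hsb
    intro p hp
    rw [Nat.add_sub_cancel, ← hhead]
    refine mul_le_mul_of_nonneg_right ?_ (sq_nonneg _)
    rcases List.mem_cons.1 hp with rfl | hp
    · exact hexp.le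
    · exact (hlt p hp).le

/-! ### Spectral data determine the polynomials -/

/-- The zeros of `b` are the elements of `σ` and `-λ a(λ) b'(λ) = γ_λ` for `λ ∈ σ`. -/
structure HasSpectralData (σ : Finset ℝ) (γ : ℝ → ℝ) (A B : ℝ[X]) : Prop where
  aeval_eq_zero_iff : ∀ z : ℂ, aeval z B = 0 ↔ ∃ x ∈ σ, (x : ℂ) = z
  norming : ∀ x ∈ σ, -(x * A.eval x) * (derivative B).eval x = γ x

lemma aeval_ofReal (P : ℝ[X]) (x : ℝ) : aeval (x : ℂ) P = ((P.eval x : ℝ) : ℂ) := by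
  have := aeval_algebraMap_apply ℂ x P
  rwa [Complex.coe_algebraMap, coe_aeval_eq_eval] at this

/-- A multiple zero would annihilate `b'` and with it the norming constant. -/
lemma HasSpectralData.roots_map {σ : Finset ℝ} {γ : ℝ → ℝ} {A B : ℝ[X]}
    (h : HasSpectralData σ γ A B) (hγ : ∀ x ∈ σ, γ x ≠ 0) (hB : B ≠ 0) :
    (B.map (algebraMap ℝ ℂ)).roots = (σ.map ⟨_, Complex.ofReal_injective⟩).val := by
  have hB' : B.map (algebraMap ℝ ℂ) ≠ 0 := Polynomial.map_ne_zero hB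
  have hmem : ∀ z, z ∈ (B.map (algebraMap ℝ ℂ)).roots ↔ ∃ x ∈ σ, (x : ℂ) = z := by
    intro z
    rw [mem_roots hB', IsRoot.def, eval_map_algebraMap, h.aeval_eq_zero_iff]
  refine (Multiset.Nodup.ext ?_ (Finset.nodup _)).2 fun z => by rw [hmem]; simp
  rw [Multiset.nodup_iff_count_le_one]
  intro z
  rw [count_roots]
  by_contra hlt
  rw [not_le, one_lt_rootMultiplicity_iff_isRoot hB'] at hlt
  obtain ⟨x, hx, rfl⟩ := (hmem z).1 ((mem_roots hB').2 hlt.1)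
  have h1 := hlt.2
  rw [IsRoot.def, derivative_map, eval_map_algebraMap, aeval_ofReal, Complex.ofReal_eq_zero] at h1
  apply hγ x hx
  rw [← h.norming x hx, h1, mul_zero]

lemma HasSpectralData.natDegree {σ : Finset ℝ} {γ : ℝ → ℝ} {A B : ℝ[X]}
    (h : HasSpectralData σ γ A B) (hγ : ∀ x ∈ σ, γ x ≠ 0) (hB : B ≠ 0) :
    B.natDegree = σ.card := by
  have h1 := (IsAlgClosed.splits (B.map (algebraMap ℝ ℂ))).natDegree_eq_card_roots
  rw [h.roots_map hγ hB, natDegree_map] at h1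
  rw [h1]; simp

/-- Over `ℂ` both polynomials are constants times the same product of linear factors, and the value
at zero fixes the constant. -/
lemma HasSpectralData.snd_unique {σ : Finset ℝ} {γ : ℝ → ℝ} {A B A' B' : ℝ[X]}
    (h : HasSpectralData σ γ A B) (h' : HasSpectralData σ γ A' B') (hγ : ∀ x ∈ σ, γ x ≠ 0)
    (hB : B.eval 0 = 1) (hB' : B'.eval 0 = 1) : B = B' := by
  have hB0 : B ≠ 0 := by rintro rfl; simp at hB
  have hB0' : B' ≠ 0 := by rintro rfl; simp at hB'
  apply map_injective _ (algebraMap ℝ ℂ).injective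
  have e : ∀ {Q : ℝ[X]}, Q.eval 0 = 1 → (Q.map (algebraMap ℝ ℂ)).eval 0 = 1 := by
    intro Q hQ
    have := aeval_ofReal Q 0
    rw [eval_map_algebraMap]
    simpa [hQ] using this
  have e1 := e hB
  have e2 := e hB'
  have s1 := (IsAlgClosed.splits (B.map (algebraMap ℝ ℂ))).eq_prod_roots
  have s2 := (IsAlgClosed.splits (B'.map (algebraMap ℝ ℂ))).eq_prod_roots
  rw [h.roots_map hγ hB0] at s1
  rw [h'.roots_map hγ hB0'] at s2
  generalize (Multiset.map (fun a => X - C a)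
    (σ.map ⟨_, Complex.ofReal_injective⟩).val).prod = R at s1 s2
  rw [s1, eval_mul, eval_C] at e1
  rw [s2, eval_mul, eval_C] at e2
  have hR : R.eval 0 ≠ 0 := right_ne_zero_of_mul (e1.trans_ne one_ne_zero)
  rw [s1, s2, mul_right_cancel₀ hR (e1.trans e2.symm)]

theorem HasSpectralData.unique {σ : Finset ℝ} {γ : ℝ → ℝ} {A B A' B' : ℝ[X]}
    (h : HasSpectralData σ γ A B) (h' : HasSpectralData σ γ A' B') (hγ : ∀ x ∈ σ, γ x ≠ 0)
    (hB : B.eval 0 = 1) (hB' : B'.eval 0 = 1) (hA : A.degree < B.degree)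
    (hA' : A'.degree < B'.degree) : A = A' ∧ B = B' := by
  have hBB := h.snd_unique h' hγ hB hB'
  refine ⟨?_, hBB⟩
  have hB0 : B ≠ 0 := by rintro rfl; simp at hB
  have hd : B.degree = σ.card := by rw [degree_eq_natDegree hB0, h.natDegree hγ hB0]
  refine eq_of_degrees_lt_of_eval_finset_eq σ (hd ▸ hA) (hd ▸ hBB ▸ hA') fun x hx => ?_
  have h1 := h.norming x hx
  have h2 := h'.norming x hx
  rw [← hBB, ← h1] at h2
  have h3 := hγ x hx
  rw [← h1] at h3
  have hB1 := right_ne_zero_of_mul h3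
  have hx0 := left_ne_zero_of_mul (neg_ne_zero.1 (left_ne_zero_of_mul h3))
  have h4 := neg_inj.1 (mul_right_cancel₀ hB1 h2)
  exact (mul_left_cancel₀ hx0 h4).symm

/-! ### Polynomials with prescribed spectral data -/

/-- The polynomial with value `1` at zero and simple zeros at `σ`. -/
def spectralPoly (σ : Finset ℝ) : ℝ[X] := ∏ x ∈ σ, (1 - C x⁻¹ * X)

/-- The quotient of `spectralPoly σ` by `x - X`. -/
def spectralQuot (σ : Finset ℝ) (x : ℝ) : ℝ[X] := C x⁻¹ * spectralPoly (σ.erase x)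

lemma spectralPoly_eq_mul {σ : Finset ℝ} {x : ℝ} (hx : x ∈ σ) (hx0 : x ≠ 0) :
    spectralPoly σ = C x * spectralQuot σ x - X * spectralQuot σ x := by
  have h : C x * C x⁻¹ = (1 : ℝ[X]) := by rw [← C_mul, mul_inv_cancel₀ hx0, C_1]
  rw [spectralPoly, ← Finset.mul_prod_erase _ _ hx, spectralQuot, spectralPoly]
  linear_combination (-∏ y ∈ σ.erase x, (1 - C y⁻¹ * X)) * h

lemma natDegree_spectralPoly_le (σ : Finset ℝ) : (spectralPoly σ).natDegree ≤ σ.card := by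
  refine (natDegree_prod_le _ _).trans ?_
  refine (Finset.sum_le_card_nsmul _ _ 1 fun x _ => ?_).trans (by simp)
  rw [show (1 : ℝ[X]) - C x⁻¹ * X = C (-x⁻¹) * X + C 1 by simp only [C_neg, C_1]; ring]
  exact natDegree_linear_le

lemma aeval_spectralPoly_eq_zero_iff {σ : Finset ℝ} (hσ : ∀ x ∈ σ, x ≠ 0) (z : ℂ) :
    aeval z (spectralPoly σ) = 0 ↔ ∃ x ∈ σ, (x : ℂ) = z := by
  rw [spectralPoly, map_prod, Finset.prod_eq_zero_iff]
  refine exists_congr fun x => and_congr_right fun hx => ?_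
  have hx0 : (x : ℂ) ≠ 0 := Complex.ofReal_ne_zero.2 (hσ x hx)
  simp only [map_sub, map_one, map_mul, aeval_C, aeval_X, Complex.coe_algebraMap,
    Complex.ofReal_inv]
  rw [sub_eq_zero, eq_comm, inv_mul_eq_one₀ hx0]

lemma spectralPoly_eval_eq_zero_iff {σ : Finset ℝ} (hσ : ∀ x ∈ σ, x ≠ 0) (y : ℝ) :
    (spectralPoly σ).eval y = 0 ↔ y ∈ σ := by
  rw [← Complex.ofReal_eq_zero, ← aeval_ofReal, aeval_spectralPoly_eq_zero_iff hσ]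
  simp

lemma spectralQuot_eval_of_ne {σ : Finset ℝ} (hσ : ∀ x ∈ σ, x ≠ 0) {x y : ℝ} (hy : y ∈ σ)
    (hyx : y ≠ x) : (spectralQuot σ x).eval y = 0 := by
  rw [spectralQuot, eval_mul, (spectralPoly_eval_eq_zero_iff
    (fun u hu => hσ u (Finset.mem_of_mem_erase hu)) y).2 (Finset.mem_erase.2 ⟨hyx, hy⟩), mul_zero]

lemma spectralQuot_eval_self_ne_zero {σ : Finset ℝ} (hσ : ∀ x ∈ σ, x ≠ 0) {x : ℝ} (hx : x ∈ σ) :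
    (spectralQuot σ x).eval x ≠ 0 := by
  rw [spectralQuot, eval_mul, eval_C]
  refine mul_ne_zero (inv_ne_zero (hσ x hx)) fun h => ?_
  have := (spectralPoly_eval_eq_zero_iff
    (fun u hu => hσ u (Finset.mem_of_mem_erase hu)) x).1 h
  simp at this

lemma spectralQuot_coeff {σ : Finset ℝ} {x : ℝ} (hx : x ∈ σ) {i : ℕ} (hi : σ.card ≤ i) :
    (spectralQuot σ x).coeff i = 0 := by
  have h1 := natDegree_spectralPoly_le (σ.erase x)
  rw [Finset.card_erase_of_mem hx] at h1
  have := Finset.card_pos.2 ⟨x, hx⟩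
  rw [spectralQuot, coeff_C_mul, coeff_eq_zero_of_natDegree_lt (by omega), mul_zero]

lemma eval_sum_spectralQuot {σ : Finset ℝ} (hσ : ∀ x ∈ σ, x ≠ 0) (r : ℝ → ℝ) {y : ℝ}
    (hy : y ∈ σ) : (∑ x ∈ σ, C (r x) * spectralQuot σ x).eval y =
      r y * (spectralQuot σ y).eval y := by
  rw [eval_finsetSum, Finset.sum_eq_single y]
  · simp
  · intro x _ hxy
    rw [eval_mul, spectralQuot_eval_of_ne hσ hy hxy.symm, mul_zero]
  · exact fun h => absurd hy h

/-- Lagrange interpolation: the quotients are a basis of the polynomials of degree below `σ.card`.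
-/
lemma sum_spectralQuot_eq {σ : Finset ℝ} (hσ : ∀ x ∈ σ, x ≠ 0) {P : ℝ[X]}
    (hP : P.degree < σ.card) :
    P = ∑ x ∈ σ, C (P.eval x / (spectralQuot σ x).eval x) * spectralQuot σ x := by
  refine eq_of_degrees_lt_of_eval_finset_eq σ hP ?_ fun y hy => ?_
  · rw [degree_lt_iff_coeff_zero]
    intro i hi
    rw [finsetSum_coeff]
    refine Finset.sum_eq_zero fun x hx => ?_
    rw [coeff_C_mul, spectralQuot_coeff hx hi, mul_zero]
  · rw [eval_sum_spectralQuot hσ (fun x => P.eval x / (spectralQuot σ x).eval x) hy,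
      div_mul_cancel₀ _ (spectralQuot_eval_self_ne_zero hσ hy)]

lemma coeffPairing_sum {ι : Type*} (s : Finset ι) (n : ℕ) (l : ℕ → ℝ) (c : ι → ℝ)
    (P : ι → ℝ[X]) : coeffPairing n l (∑ x ∈ s, C (c x) * P x) =
      ∑ x ∈ s, c x * coeffPairing n l (P x) := by
  simp only [coeffPairing, finsetSum_coeff, coeff_C_mul, Finset.mul_sum]
  rw [Finset.sum_comm]
  exact Finset.sum_congr rfl fun _ _ => Finset.sum_congr rfl fun _ _ => by ring

/-- Since `spectralPoly σ` is `(x - X)` times each quotient, the form is a weighted sum of squares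
of pairings with the quotients. These span, so only the zero functional annihilates them all. -/
lemma bezoutPos_spectralPoly {σ : Finset ℝ} (hσ : ∀ x ∈ σ, x ≠ 0) {r : ℝ → ℝ}
    (hr : ∀ x ∈ σ, 0 < r x) :
    BezoutPos σ.card (∑ x ∈ σ, C (r x) * spectralQuot σ x) (spectralPoly σ) := by
  rintro l ⟨i, hi, hli⟩
  have hform : bezoutForm σ.card (∑ x ∈ σ, C (r x) * spectralQuot σ x) (spectralPoly σ) l =
      ∑ x ∈ σ, r x * coeffPairing σ.card l (spectralQuot σ x) ^ 2 := by
    rw [bezoutForm_sum_left]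
    refine Finset.sum_congr rfl fun x hx => ?_
    have : C x * spectralQuot σ x - X * spectralQuot σ x =
        C x * spectralQuot σ x + C (-1) * (X * spectralQuot σ x) := by
      simp only [C_neg, C_1]; ring
    rw [bezoutForm_C_mul_left, spectralPoly_eq_mul hx (hσ x hx), this, bezoutForm_add_right,
      bezoutForm_C_mul_right, bezoutForm_C_mul_right, bezoutForm_self, bezoutForm_self_X_mul]
    ring
  rw [hform]
  have hnn : ∀ x ∈ σ, 0 ≤ r x * coeffPairing σ.card l (spectralQuot σ x) ^ 2 := fun x hx =>
    mul_nonneg (hr x hx).le (sq_nonneg _)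
  refine lt_of_le_of_ne (Finset.sum_nonneg hnn) fun h0 => hli ?_
  have hz := (Finset.sum_eq_zero_iff_of_nonneg hnn).1 h0.symm
  have hX : l i = coeffPairing σ.card l (X ^ i) := by
    rw [coeffPairing, Finset.sum_eq_single i]
    · simp
    · intro j _ hj; simp [coeff_X_pow, hj]
    · intro h; exact absurd (Finset.mem_range.2 hi) h
  rw [hX, sum_spectralQuot_eq hσ (P := X ^ i) (by rw [degree_X_pow]; exact_mod_cast hi),
    coeffPairing_sum]
  refine Finset.sum_eq_zero fun x hx => ?_
  rcases mul_eq_zero.1 (hz x hx) with h | h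
  · exact absurd h (hr x hx).ne'
  · rw [pow_eq_zero_iff two_ne_zero] at h; rw [h, mul_zero]

theorem exists_hasSpectralData (σ : Finset ℝ) (γ : ℝ → ℝ) (hγ : ∀ x ∈ σ, 0 < x * γ x) :
    ∃ A B, IsJostPair σ.card A B ∧ HasSpectralData σ γ A B := by
  have hσ : ∀ x ∈ σ, x ≠ 0 := fun x hx => left_ne_zero_of_mul (hγ x hx).ne'
  have hpos : ∀ x ∈ σ, 0 < γ x / (x * (spectralQuot σ x).eval x ^ 2) := by
    intro x hx
    have h1 := hσ x hx
    have h2 := spectralQuot_eval_self_ne_zero hσ hx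
    have : γ x / (x * (spectralQuot σ x).eval x ^ 2) =
        x * γ x / (x * (spectralQuot σ x).eval x) ^ 2 := by field_simp
    rw [this]
    exact div_pos (hγ x hx) (by positivity)
  -- With `q` the quotient at `x`, `a(x) = r q(x)` and `b'(x) = -q(x)`, so `-x a(x) b'(x) = γ x`
  -- forces `r = γ x / (x q(x)²)`.
  refine ⟨∑ x ∈ σ, C (γ x / (x * (spectralQuot σ x).eval x ^ 2)) * spectralQuot σ x,
    spectralPoly σ, ⟨fun i hi => ?_, natDegree_spectralPoly_le σ, ?_, ?_⟩,
    ⟨aeval_spectralPoly_eq_zero_iff hσ, fun x hx => ?_⟩⟩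
  · rw [finsetSum_coeff]
    refine Finset.sum_eq_zero fun x hx => ?_
    rw [coeff_C_mul, spectralQuot_coeff hx hi, mul_zero]
  · simp [spectralPoly, eval_prod]
  · exact bezoutPos_spectralPoly hσ hpos
  · have h1 := hσ x hx
    have h2 := spectralQuot_eval_self_ne_zero hσ hx
    rw [eval_sum_spectralQuot hσ (fun x => γ x / (x * (spectralQuot σ x).eval x ^ 2)) hx]
    have h3 : (derivative (spectralPoly σ)).eval x = -(spectralQuot σ x).eval x := by
      rw [spectralPoly_eq_mul hx h1]
      simp
    rw [h3]
    field_simp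

/-! ### The equation between and at the point masses -/

/-- The general solution of `-f'' + f / 4 = 0`. -/
def expPair (a b : ℂ) (t : ℝ) : ℂ := a * (Real.exp (t / 2) : ℂ) + b * (Real.exp (-t / 2) : ℂ)

lemma hasDerivAt_expPair (a b : ℂ) (t : ℝ) :
    HasDerivAt (expPair a b) (expPair (a / 2) (-b / 2) t) t := by
  have h1 : HasDerivAt (fun t : ℝ => Real.exp (t / 2)) (Real.exp (t / 2) * (1 / 2)) t :=
    ((hasDerivAt_id t).div_const 2).exp
  have h2 : HasDerivAt (fun t : ℝ => Real.exp (-t / 2)) (Real.exp (-t / 2) * (-1 / 2)) t :=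
    ((hasDerivAt_id t).neg.div_const 2).exp
  have h := (h1.ofReal_comp.const_mul a).add (h2.ofReal_comp.const_mul b)
  refine h.congr_deriv ?_
  rw [expPair]
  push_cast
  ring

lemma deriv_expPair (a b : ℂ) : deriv (expPair a b) = expPair (a / 2) (-b / 2) :=
  funext fun t => (hasDerivAt_expPair a b t).deriv

lemma continuous_expPair (a b : ℂ) : Continuous (expPair a b) :=
  continuous_iff_continuousAt.2 fun t => (hasDerivAt_expPair a b t).continuousAt

lemma exp_half_mul_exp_neg_half (t : ℝ) :
    (Real.exp (t / 2) : ℂ) * (Real.exp (-t / 2) : ℂ) = 1 := by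
  rw [← Complex.ofReal_mul, ← Real.exp_add]
  simp [neg_div]

lemma const_mul_expPair (c a b : ℂ) (t : ℝ) : c * expPair a b t = expPair (c * a) (c * b) t := by
  simp only [expPair]; ring

lemma expPair_neg (a b : ℂ) (t : ℝ) : expPair a b (-t) = expPair b a t := by
  simp only [expPair, neg_neg]; ring

/-- The differential equation at a point that carries no mass. -/
def FreeAt (f : ℝ → ℂ) (t : ℝ) : Prop :=
  DifferentiableAt ℝ f t ∧ DifferentiableAt ℝ (deriv f) t ∧ -deriv (deriv f) t + (1 / 4) * f t = 0

/-- The interface condition with mass `m`. -/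
def InterfaceAt (m : ℂ) (f : ℝ → ℂ) (t : ℝ) : Prop :=
  ContinuousAt f t ∧ ∃ dl dr : ℂ, Tendsto (deriv f) (𝓝[<] t) (𝓝 dl) ∧
    Tendsto (deriv f) (𝓝[>] t) (𝓝 dr) ∧ dl = m * f t + dr

lemma freeAt_expPair (a b : ℂ) (t : ℝ) : FreeAt (expPair a b) t := by
  rw [FreeAt, deriv_expPair, deriv_expPair]
  refine ⟨(hasDerivAt_expPair _ _ t).differentiableAt, (hasDerivAt_expPair _ _ t).differentiableAt,
    ?_⟩
  simp only [expPair]; ring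

lemma FreeAt.congr {f g : ℝ → ℂ} {t : ℝ} (h : FreeAt g t) (hfg : f =ᶠ[𝓝 t] g) : FreeAt f t := by
  have hd : deriv f =ᶠ[𝓝 t] deriv g := hfg.deriv
  refine ⟨hfg.differentiableAt_iff.2 h.1, hd.differentiableAt_iff.2 h.2.1, ?_⟩
  rw [hd.deriv_eq, hfg.eq_of_nhds]
  exact h.2.2

lemma InterfaceAt.congr {m : ℂ} {f g : ℝ → ℂ} {t : ℝ} (h : InterfaceAt m g t)
    (hfg : f =ᶠ[𝓝 t] g) : InterfaceAt m f t := by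
  obtain ⟨hc, dl, dr, h1, h2, h3⟩ := h
  have hd : deriv f =ᶠ[𝓝 t] deriv g := hfg.deriv
  refine ⟨hc.congr hfg.symm, dl, dr, h1.congr' ?_, h2.congr' ?_, ?_⟩
  · exact (hd.filter_mono nhdsWithin_le_nhds).symm
  · exact (hd.filter_mono nhdsWithin_le_nhds).symm
  · rw [hfg.eq_of_nhds]; exact h3

lemma exists_expPair_of_freeAt {f : ℝ → ℂ} {s : Set ℝ} (hs : IsOpen s) (hs' : IsPreconnected s)
    (h : ∀ t ∈ s, FreeAt f t) : ∃ a b : ℂ, ∀ t ∈ s, f t = expPair a b t := by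
  rcases s.eq_empty_or_nonempty with rfl | ⟨x, hx⟩
  · exact ⟨0, 0, by simp⟩
  have he1 : ∀ t : ℝ, HasDerivAt (fun t : ℝ => (Real.exp (t / 2) : ℂ))
      ((Real.exp (t / 2) : ℂ) * (1 / 2)) t := fun t => by
    have := hasDerivAt_expPair 1 0 t
    convert this using 1
    · funext u; simp [expPair]
    · simp [expPair]; ring
  have he2 : ∀ t : ℝ, HasDerivAt (fun t : ℝ => (Real.exp (-t / 2) : ℂ))
      ((Real.exp (-t / 2) : ℂ) * (-1 / 2)) t := fun t => by
    have := hasDerivAt_expPair 0 1 t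
    convert this using 1
    · funext u; simp [expPair]
    · simp [expPair]; ring
  -- `(f/2 + f') e^{-t/2}` and `(f/2 - f') e^{t/2}` are first integrals; their values are the two
  -- coefficients.
  have hu : ∀ t ∈ s, HasDerivAt (fun t => (f t / 2 + deriv f t) * (Real.exp (-t / 2) : ℂ)) 0 t := by
    intro t ht
    obtain ⟨h1, h2, h3⟩ := h t ht
    have := ((h1.hasDerivAt.div_const 2).add h2.hasDerivAt).mul (he2 t)
    refine this.congr_deriv ?_
    simp only [Pi.add_apply]
    linear_combination (-(Real.exp (-t / 2) : ℂ)) * h3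
  have hv : ∀ t ∈ s, HasDerivAt (fun t => (f t / 2 - deriv f t) * (Real.exp (t / 2) : ℂ)) 0 t := by
    intro t ht
    obtain ⟨h1, h2, h3⟩ := h t ht
    have := ((h1.hasDerivAt.div_const 2).sub h2.hasDerivAt).mul (he1 t)
    refine this.congr_deriv ?_
    simp only [Pi.sub_apply]
    linear_combination ((Real.exp (t / 2) : ℂ)) * h3
  refine ⟨(f x / 2 + deriv f x) * (Real.exp (-x / 2) : ℂ),
    (f x / 2 - deriv f x) * (Real.exp (x / 2) : ℂ), fun t ht => ?_⟩
  have eu := hs.is_const_of_deriv_eq_zero hs'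
    (fun t ht => (hu t ht).differentiableAt.differentiableWithinAt) (fun t ht => (hu t ht).deriv)
    hx ht
  have ev := hs.is_const_of_deriv_eq_zero hs'
    (fun t ht => (hv t ht).differentiableAt.differentiableWithinAt) (fun t ht => (hv t ht).deriv)
    hx ht
  rw [expPair, eu, ev]
  linear_combination (-f t) * exp_half_mul_exp_neg_half t

lemma expPair_injective {a b a' b' : ℂ} {x : ℝ} (h : expPair a b x = expPair a' b' x)
    (h' : expPair (a / 2) (-b / 2) x = expPair (a' / 2) (-b' / 2) x) : a = a' ∧ b = b' := by
  have he := exp_half_mul_exp_neg_half x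
  simp only [expPair] at h h'
  constructor
  · linear_combination (a' - a) * he + (Real.exp (-x / 2) : ℂ) * (h / 2 + h')
  · linear_combination (b' - b) * he + (Real.exp (x / 2) : ℂ) * (h / 2 - h')

lemma eq_zero_of_expPair_bounded {a b : ℂ} {M K : ℝ} (h : ∀ t > M, ‖expPair a b t‖ ≤ K) :
    a = 0 := by
  have hb : ∀ᶠ t : ℝ in atTop, ‖a‖ ≤ (K + ‖b‖) * Real.exp (-t / 2) := by
    filter_upwards [eventually_gt_atTop M, eventually_ge_atTop 0] with t ht ht0
    have e : a = (expPair a b t - b * (Real.exp (-t / 2) : ℂ)) * (Real.exp (-t / 2) : ℂ) := by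
      rw [expPair]
      linear_combination (-a) * exp_half_mul_exp_neg_half t
    have h1 : Real.exp (-t / 2) ≤ 1 := Real.exp_le_one_iff.2 (by linarith)
    have hn : ∀ r : ℝ, ‖(Real.exp r : ℂ)‖ = Real.exp r := fun r => by
      rw [Complex.norm_real, Real.norm_eq_abs, Real.abs_exp]
    calc ‖a‖ = ‖expPair a b t - b * (Real.exp (-t / 2) : ℂ)‖ * Real.exp (-t / 2) := by
          conv_lhs => rw [e]
          rw [norm_mul, hn]
      _ ≤ (K + ‖b‖) * Real.exp (-t / 2) := by
          refine mul_le_mul_of_nonneg_right ?_ (Real.exp_pos _).le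
          refine (norm_sub_le _ _).trans (add_le_add (h t ht) ?_)
          rw [norm_mul, hn]
          exact mul_le_of_le_one_right (norm_nonneg _) h1
  have ht : Tendsto (fun t : ℝ => (K + ‖b‖) * Real.exp (-t / 2)) atTop (𝓝 ((K + ‖b‖) * 0)) := by
    refine (Real.tendsto_exp_atBot.comp ?_).const_mul _
    exact tendsto_neg_atTop_atBot.atBot_div_const two_pos
  rw [mul_zero] at ht
  exact norm_le_zero_iff.1 (ge_of_tendsto ht hb)

/-! ### The solution `φ₊` and its uniqueness -/

/-- The solution `φ₊(z, ·)` continued to the left of all point masses. -/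
def leftExp (L : List PointMass) (z : ℂ) : ℝ → ℂ :=
  expPair (z * aeval z (jost L).1) (aeval z (jost L).2)

/-- The solution `φ₊(z, ·)`. -/
def phiPlus : List PointMass → ℂ → ℝ → ℂ
  | [], _ => expPair 0 1
  | p :: L, z => fun t => if t ≤ p.pos then leftExp (p :: L) z t else phiPlus L z t

lemma phiPlus_cons_of_le {p : PointMass} {t : ℝ} (L : List PointMass) (z : ℂ) (h : t ≤ p.pos) :
    phiPlus (p :: L) z t = leftExp (p :: L) z t := if_pos h

lemma phiPlus_cons_of_lt {p : PointMass} {t : ℝ} (L : List PointMass) (z : ℂ) (h : p.pos < t) :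
    phiPlus (p :: L) z t = phiPlus L z t := if_neg (not_le.2 h)

lemma phiPlus_eq_leftExp {L : List PointMass} (z : ℂ) {t : ℝ} (h : ∀ p ∈ L, t ≤ p.pos) :
    phiPlus L z t = leftExp L z t := by
  cases L with
  | nil => simp [phiPlus, leftExp, jost]
  | cons p L => exact phiPlus_cons_of_le L z (h p (by simp))

lemma phiPlus_eq_expPair {L : List PointMass} (z : ℂ) {t : ℝ} (h : ∀ p ∈ L, p.pos < t) :
    phiPlus L z t = expPair 0 1 t := by
  induction L with
  | nil => rfl
  | cons p L ih =>
    rw [phiPlus_cons_of_lt L z (h p (by simp)), ih fun q hq => h q (List.mem_cons_of_mem _ hq)]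

lemma leftExp_eq (L : List PointMass) (z : ℂ) (x : ℝ) :
    leftExp L z x = (Real.exp (x / 2) : ℂ) * aeval z (siteValue x L) := by
  have h : (Real.exp (-x / 2) : ℂ) = (Real.exp (x / 2) : ℂ) * (Real.exp (-x) : ℂ) := by
    rw [← Complex.ofReal_mul, ← Real.exp_add]; congr 2; ring
  simp only [leftExp, expPair, siteValue, map_add, map_mul, aeval_X, aeval_C,
    Complex.coe_algebraMap]
  rw [h]; ring

/-- The mass `z ω + z² υ` in the interface condition. -/
def PointMass.mass (p : PointMass) (z : ℂ) : ℂ := z * (p.weight : ℂ) + z ^ 2 * (p.dipole : ℂ)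

lemma leftExp_cons (p : PointMass) (L : List PointMass) (z : ℂ) :
    leftExp (p :: L) z p.pos = leftExp L z p.pos := by
  rw [leftExp_eq, leftExp_eq, siteValue_cons]

lemma deriv_leftExp_cons (p : PointMass) (L : List PointMass) (z : ℂ) :
    deriv (leftExp (p :: L) z) p.pos =
      p.mass z * leftExp L z p.pos + deriv (leftExp L z) p.pos := by
  have h : (Real.exp p.pos : ℂ) * (Real.exp (-p.pos / 2) : ℂ) = (Real.exp (p.pos / 2) : ℂ) := by
    rw [← Complex.ofReal_mul, ← Real.exp_add]; congr 2; ring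
  rw [leftExp_eq L, leftExp, leftExp, deriv_expPair, deriv_expPair, jost_cons_fst, jost_cons_snd]
  simp only [expPair, map_add, map_sub, map_mul, aeval_X, aeval_C, Complex.coe_algebraMap,
    PointMass.strength, PointMass.mass]
  linear_combination (z * (↑p.weight + ↑p.dipole * z) * aeval z (siteValue p.pos L) / 2) * h

lemma tendsto_deriv_left {f : ℝ → ℂ} {a b : ℂ} {c x : ℝ} (hc : c < x)
    (h : ∀ t ∈ Set.Ioo c x, f t = expPair a b t) :
    Tendsto f (𝓝[<] x) (𝓝 (expPair a b x)) ∧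
      Tendsto (deriv f) (𝓝[<] x) (𝓝 (deriv (expPair a b) x)) := by
  have hmem := Ioo_mem_nhdsLT hc
  refine ⟨((continuous_expPair a b).tendsto x |>.mono_left nhdsWithin_le_nhds).congr' ?_, ?_⟩
  · filter_upwards [hmem] with t ht using (h t ht).symm
  · rw [deriv_expPair]
    refine ((continuous_expPair _ _).tendsto x |>.mono_left nhdsWithin_le_nhds).congr' ?_
    filter_upwards [hmem] with t ht
    rw [← deriv_expPair]
    refine (Filter.EventuallyEq.deriv_eq ?_).symm
    filter_upwards [isOpen_Ioo.mem_nhds ht] with u hu using h u hu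

lemma tendsto_deriv_right {f : ℝ → ℂ} {a b : ℂ} {x d : ℝ} (hd : x < d)
    (h : ∀ t ∈ Set.Ioo x d, f t = expPair a b t) :
    Tendsto f (𝓝[>] x) (𝓝 (expPair a b x)) ∧
      Tendsto (deriv f) (𝓝[>] x) (𝓝 (deriv (expPair a b) x)) := by
  have hmem := Ioo_mem_nhdsGT hd
  refine ⟨((continuous_expPair a b).tendsto x |>.mono_left nhdsWithin_le_nhds).congr' ?_, ?_⟩
  · filter_upwards [hmem] with t ht using (h t ht).symm
  · rw [deriv_expPair]
    refine ((continuous_expPair _ _).tendsto x |>.mono_left nhdsWithin_le_nhds).congr' ?_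
    filter_upwards [hmem] with t ht
    rw [← deriv_expPair]
    refine (Filter.EventuallyEq.deriv_eq ?_).symm
    filter_upwards [isOpen_Ioo.mem_nhds ht] with u hu using h u hu

lemma exists_gap {x : ℝ} {L : List PointMass} (h : ∀ q ∈ L, x < q.pos) :
    ∃ d > x, ∀ q ∈ L, d ≤ q.pos := by
  induction L with
  | nil => exact ⟨x + 1, by simp, by simp⟩
  | cons p L ih =>
    obtain ⟨d, hd, hL⟩ := ih fun q hq => h q (List.mem_cons_of_mem _ hq)
    refine ⟨min d p.pos, lt_min hd (h p (by simp)), fun q hq => ?_⟩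
    rcases List.mem_cons.1 hq with rfl | hq
    · exact min_le_right _ _
    · exact (min_le_left _ _).trans (hL q hq)

/-- `f` solves the spectral problem for the point masses `L` on the set `s`. -/
def SolvesOn (s : Set ℝ) (L : List PointMass) (z : ℂ) (f : ℝ → ℂ) : Prop :=
  (∀ t ∈ s, (∀ p ∈ L, p.pos ≠ t) → FreeAt f t) ∧
    ∀ p ∈ L, p.pos ∈ s → InterfaceAt (p.mass z) f p.pos

lemma solvesOn_phiPlus {L : List PointMass} (hL : Admissible L) (z : ℂ) :
    SolvesOn Set.univ L z (phiPlus L z) := by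
  induction L with
  | nil => exact ⟨fun t _ _ => freeAt_expPair 0 1 t, by simp⟩
  | cons p L ih =>
    have hright : ∀ t, p.pos < t → phiPlus (p :: L) z =ᶠ[𝓝 t] phiPlus L z := fun t ht => by
      filter_upwards [isOpen_Ioi.mem_nhds ht] with u hu using phiPlus_cons_of_lt L z hu
    have ih := ih hL.tail
    refine ⟨fun t _ ht => ?_, fun q hq _ => ?_⟩
    · rcases lt_or_gt_of_ne (ht p (by simp)) with h | h
      · exact (ih.1 t trivial fun q hq => ht q (List.mem_cons_of_mem _ hq)).congr (hright t h)
      · refine (freeAt_expPair _ _ t).congr (g := leftExp (p :: L) z) ?_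
        filter_upwards [isOpen_Iio.mem_nhds h] with u hu using phiPlus_cons_of_le L z (le_of_lt hu)
    · rcases List.mem_cons.1 hq with rfl | hq
      · obtain ⟨d, hd, hdL⟩ := exists_gap hL.lt
        have hl := tendsto_deriv_left (f := phiPlus (q :: L) z) (c := q.pos - 1) (by linarith)
          fun t ht => phiPlus_cons_of_le L z ht.2.le
        have hr := tendsto_deriv_right (f := phiPlus (q :: L) z) hd fun t ht =>
          (phiPlus_cons_of_lt L z ht.1).trans
            (phiPlus_eq_leftExp z fun p hp => ht.2.le.trans (hdL p hp))
        have hx : phiPlus (q :: L) z q.pos = leftExp L z q.pos :=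
          (phiPlus_cons_of_le L z le_rfl).trans (leftExp_cons q L z)
        refine ⟨continuousAt_iff_continuous_left'_right'.2 ⟨?_, ?_⟩, _, _, hl.2, hr.2, ?_⟩
        · rw [ContinuousWithinAt, hx, ← leftExp_cons]; exact hl.1
        · rw [ContinuousWithinAt, hx]; exact hr.1
        · rw [hx]; exact deriv_leftExp_cons q L z
      · exact (ih.2 q hq trivial).congr (hright _ (hL.lt q hq))

/-- Continuation from right to left: at each mass, continuity and the jump condition fix value and
left derivative, hence both exponential coefficients. The half-line `Ioi c` lets the induction apply
to the right of the leftmost mass. -/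
lemma SolvesOn.eq_phiPlus {L : List PointMass} (hL : Admissible L) {z b : ℂ} {f : ℝ → ℂ} {c : ℝ}
    (hc : ∀ p ∈ L, c < p.pos) (hf : SolvesOn (Set.Ioi c) L z f)
    (hright : ∀ t > c, (∀ p ∈ L, p.pos < t) → f t = b * expPair 0 1 t) :
    ∀ t > c, f t = b * phiPlus L z t := by
  induction L generalizing c with
  | nil => exact fun t ht => hright t ht (by simp)
  | cons p L ih =>
    have hcp := hc p (by simp)
    have ih' := ih hL.tail hL.lt
      ⟨fun t ht h => hf.1 t (hcp.trans ht) fun q hq => by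
        rcases List.mem_cons.1 hq with rfl | hq
        · exact ne_of_lt ht
        · exact h q hq,
        fun q hq hs => hf.2 q (List.mem_cons_of_mem _ hq) (hcp.trans hs)⟩
      (fun t ht h => hright t (hcp.trans ht) fun q hq => by
        rcases List.mem_cons.1 hq with rfl | hq
        · exact ht
        · exact h q hq)
    obtain ⟨a₁, b₁, h₁⟩ := exists_expPair_of_freeAt (s := Set.Ioo c p.pos) isOpen_Ioo
      isPreconnected_Ioo fun t ht => hf.1 t ht.1 fun q hq => by
        rcases List.mem_cons.1 hq with rfl | hq
        · exact ht.2.ne'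
        · exact (ht.2.trans (hL.lt q hq)).ne'
    obtain ⟨d, hd, hdL⟩ := exists_gap hL.lt
    have hl := tendsto_deriv_left hcp h₁
    have hr := tendsto_deriv_right (f := f) hd fun t ht => by
      rw [ih' t ht.1, phiPlus_eq_leftExp z fun q hq => ht.2.le.trans (hdL q hq), leftExp,
        const_mul_expPair]
    obtain ⟨hcont, dl, dr, hdl, hdr, hjump⟩ := hf.2 p (by simp) hcp
    rw [tendsto_nhds_unique hdl hl.2, tendsto_nhds_unique hdr hr.2] at hjump
    have hfl := tendsto_nhds_unique (hcont.tendsto.mono_left nhdsWithin_le_nhds) hl.1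
    have hfr := tendsto_nhds_unique (hcont.tendsto.mono_left nhdsWithin_le_nhds) hr.1
    have hscale : ∀ M : List PointMass, expPair (b * (z * aeval z (jost M).1))
        (b * aeval z (jost M).2) = fun t => b * leftExp M z t := fun M => by
      funext t; rw [leftExp, const_mul_expPair]
    have hdscale : ∀ M : List PointMass, deriv (fun t => b * leftExp M z t) p.pos =
        b * deriv (leftExp M z) p.pos := fun M => by
      rw [deriv_const_mul]
      exact (hasDerivAt_expPair _ _ _).differentiableAt
    rw [hscale] at hfr hjump
    beta_reduce at hfr
    have hval : expPair a₁ b₁ p.pos = expPair (b * (z * aeval z (jost (p :: L)).1))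
        (b * aeval z (jost (p :: L)).2) p.pos := by
      rw [hscale, ← hfl, hfr]
      beta_reduce
      rw [leftExp_cons]
    have hder : deriv (expPair a₁ b₁) p.pos = deriv (expPair (b * (z * aeval z (jost (p :: L)).1))
        (b * aeval z (jost (p :: L)).2)) p.pos := by
      rw [hjump, hfr, hscale, hdscale, hdscale, deriv_leftExp_cons]
      ring
    rw [deriv_expPair, deriv_expPair] at hder
    obtain ⟨rfl, rfl⟩ := expPair_injective hval hder
    intro t ht
    rcases lt_trichotomy t p.pos with h | rfl | h
    · rw [phiPlus_cons_of_le L z h.le, h₁ t ⟨ht, h⟩, hscale]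
    · rw [phiPlus_cons_of_le L z le_rfl, hfr, leftExp_cons]
    · rw [phiPlus_cons_of_lt L z h, ih' t h]

lemma exists_lt_pos (L : List PointMass) : ∃ c : ℝ, ∀ p ∈ L, c < p.pos := by
  induction L with
  | nil => exact ⟨0, by simp⟩
  | cons p L ih =>
    obtain ⟨c, hc⟩ := ih
    refine ⟨min c (p.pos - 1), fun q hq => ?_⟩
    rcases List.mem_cons.1 hq with rfl | hq
    · exact (min_le_right _ _).trans_lt (by linarith)
    · exact (min_le_left _ _).trans_lt (hc q hq)

lemma exists_pos_lt (L : List PointMass) : ∃ d : ℝ, ∀ p ∈ L, p.pos < d := by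
  induction L with
  | nil => exact ⟨0, by simp⟩
  | cons p L ih =>
    obtain ⟨c, hc⟩ := ih
    refine ⟨max c (p.pos + 1), fun q hq => ?_⟩
    rcases List.mem_cons.1 hq with rfl | hq
    · exact lt_of_lt_of_le (by linarith) (le_max_right _ _)
    · exact (hc q hq).trans_le (le_max_left _ _)

lemma SolvesOn.exists_right {L : List PointMass} {z : ℂ} {f : ℝ → ℂ}
    (hf : SolvesOn Set.univ L z f) :
    ∃ a b : ℂ, ∀ t, (∀ p ∈ L, p.pos < t) → f t = expPair a b t := by
  obtain ⟨a, b, h⟩ := exists_expPair_of_freeAt (f := f) (s := {t | ∀ p ∈ L, p.pos < t}) (by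
      have : {t | ∀ p ∈ L, p.pos < t} = ⋂ p ∈ {p | p ∈ L}, Set.Ioi (PointMass.pos p) := by
        ext t; simp
      rw [this]
      exact (List.finite_toSet L).isOpen_biInter fun p _ => isOpen_Ioi)
    (Set.OrdConnected.isPreconnected ⟨fun x hx y hy t ht p hp => (hx p hp).trans_le ht.1⟩)
    fun t ht => hf.1 t trivial fun p hp => (ht p hp).ne
  exact ⟨a, b, h⟩

lemma SolvesOn.eq_mul_phiPlus {L : List PointMass} (hL : Admissible L) {z b : ℂ} {f : ℝ → ℂ}
    (hf : SolvesOn Set.univ L z f)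
    (hright : ∀ t, (∀ p ∈ L, p.pos < t) → f t = expPair 0 b t) (t : ℝ) :
    f t = b * phiPlus L z t := by
  obtain ⟨c, hc⟩ := exists_lt_pos L
  refine SolvesOn.eq_phiPlus hL (c := min c (t - 1))
    (fun p hp => (min_le_left _ _).trans_lt (hc p hp))
    ⟨fun u _ h => hf.1 u trivial h, fun p hp _ => hf.2 p hp trivial⟩ (fun u _ hu => ?_) t
    ((min_le_right _ _).trans_lt (by linarith))
  rw [hright u hu, const_mul_expPair, mul_zero, mul_one]

lemma SolvesOn.eq_phiPlus_of_eventually {L : List PointMass} (hL : Admissible L) {z : ℂ}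
    {f : ℝ → ℂ} (hf : SolvesOn Set.univ L z f)
    (h : ∀ᶠ x : ℝ in atTop, f x = (Real.exp (-x / 2) : ℂ)) : f = phiPlus L z := by
  obtain ⟨a, b, hab⟩ := hf.exists_right
  obtain ⟨d, hd⟩ := exists_pos_lt L
  obtain ⟨M, hM⟩ := eventually_atTop.1 h
  have hdiff : ∀ t > max M d, expPair a (b - 1) t = 0 := by
    intro t ht
    have h1 := hM t ((le_max_left _ _).trans ht.le)
    rw [hab t fun p hp => (hd p hp).trans ((le_max_right _ _).trans_lt ht)] at h1
    simp only [expPair] at h1 ⊢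
    linear_combination h1
  have ha : a = 0 := eq_zero_of_expPair_bounded (K := 0) fun t ht => by rw [hdiff t ht, norm_zero]
  have hb : b = 1 := by
    have := hdiff (max M d + 1) (by linarith)
    rw [ha, expPair, zero_mul, zero_add, mul_eq_zero, Complex.ofReal_eq_zero] at this
    exact sub_eq_zero.1 (this.resolve_right (Real.exp_pos _).ne')
  subst ha hb
  funext t
  rw [hf.eq_mul_phiPlus hL hab, one_mul]

lemma phiPlus_ne_zero (L : List PointMass) (z : ℂ) : phiPlus L z ≠ 0 := fun h => by
  obtain ⟨d, hd⟩ := exists_pos_lt L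
  have := phiPlus_eq_expPair z hd
  simp only [h, expPair, Pi.zero_apply, zero_mul, one_mul, zero_add] at this
  exact (Real.exp_pos _).ne (Complex.ofReal_eq_zero.1 this.symm).symm

lemma norm_expPair_le {a b : ℂ} {c d t : ℝ} (hc : c ≤ t) (hd : t ≤ d) :
    ‖expPair a b t‖ ≤ ‖a‖ * Real.exp (d / 2) + ‖b‖ * Real.exp (-c / 2) := by
  refine (norm_add_le _ _).trans ?_
  rw [norm_mul, norm_mul, Complex.norm_real, Complex.norm_real, Real.norm_eq_abs, Real.norm_eq_abs,
    Real.abs_exp, Real.abs_exp]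
  gcongr

lemma exists_norm_phiPlus_le (L : List PointMass) (z : ℂ) (c : ℝ) :
    ∃ K, ∀ t, c ≤ t → ‖phiPlus L z t‖ ≤ K := by
  induction L generalizing c with
  | nil =>
    exact ⟨Real.exp (-c / 2), fun t ht =>
      (norm_expPair_le (d := t) ht le_rfl).trans_eq (by simp)⟩
  | cons p L ih =>
    obtain ⟨K, hK⟩ := ih p.pos
    refine ⟨max K (‖z * aeval z (jost (p :: L)).1‖ * Real.exp (p.pos / 2) +
      ‖aeval z (jost (p :: L)).2‖ * Real.exp (-c / 2)), fun t ht => ?_⟩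
    rcases le_or_gt t p.pos with h | h
    · rw [phiPlus_cons_of_le L z h]
      exact (norm_expPair_le ht h).trans (le_max_right _ _)
    · rw [phiPlus_cons_of_lt L z h]
      exact (hK t h.le).trans (le_max_left _ _)

/-! ### Spectrum and norming constants in terms of the polynomials -/

theorem phiPlus_bounded_iff (L : List PointMass) (z : ℂ) :
    (∃ K : ℝ, ∀ t, ‖phiPlus L z t‖ ≤ K) ↔ aeval z (jost L).2 = 0 := by
  obtain ⟨c, hc⟩ := exists_lt_pos L
  have hleft : ∀ t ≤ c, phiPlus L z t = leftExp L z t := fun t ht =>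
    phiPlus_eq_leftExp z fun p hp => ht.trans (hc p hp).le
  constructor
  · rintro ⟨K, hK⟩
    -- Reflection `t ↦ -t` exchanges the two coefficients, so growth at `-∞` is read off as growth
    -- at `+∞`.
    refine eq_zero_of_expPair_bounded (b := z * aeval z (jost L).1) (M := -c) (K := K)
      fun t ht => ?_
    have := hK (-t)
    rwa [hleft (-t) (by linarith), leftExp, expPair_neg] at this
  · intro h
    obtain ⟨K, hK⟩ := exists_norm_phiPlus_le L z c
    refine ⟨max K (‖z * aeval z (jost L).1‖ * Real.exp (c / 2)), fun t => ?_⟩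
    rcases le_or_gt t c with ht | ht
    · rw [hleft t ht, leftExp, h]
      refine ((norm_expPair_le (c := t) le_rfl ht).trans_eq ?_).trans (le_max_right _ _)
      simp
    · exact (hK t ht.le).trans (le_max_left _ _)

lemma exists_bounded_solution_iff {L : List PointMass} (hL : Admissible L) (z : ℂ) :
    (∃ f : ℝ → ℂ, SolvesOn Set.univ L z f ∧ f ≠ 0 ∧ ∃ K : ℝ, ∀ x, ‖f x‖ ≤ K) ↔
      aeval z (jost L).2 = 0 := by
  constructor
  · rintro ⟨f, hf, hf0, K, hK⟩
    obtain ⟨a, b, hab⟩ := hf.exists_right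
    obtain ⟨d, hd⟩ := exists_pos_lt L
    have ha : a = 0 := eq_zero_of_expPair_bounded (M := d) (K := K) fun t ht => by
      rw [← hab t fun p hp => (hd p hp).trans ht]; exact hK t
    subst ha
    have hfb := hf.eq_mul_phiPlus hL hab
    have hb : b ≠ 0 := by
      rintro rfl
      exact hf0 (funext fun t => by rw [hfb t, zero_mul]; rfl)
    refine (phiPlus_bounded_iff L z).1 ⟨‖b‖⁻¹ * K, fun t => ?_⟩
    have := hK t
    rw [hfb t, norm_mul] at this
    rwa [le_inv_mul_iff₀ (norm_pos_iff.2 hb)]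
  · intro h
    exact ⟨_, solvesOn_phiPlus hL z, phiPlus_ne_zero L z, (phiPlus_bounded_iff L z).2 h⟩

/-- For real parameter `φ₊` is real, and its square at a mass is `e^{p.pos}` times the squared site
value, matching the Wronskian increment. -/
theorem sum_norm_phiPlus_sq {L : List PointMass} (hL : Admissible L) (x : ℝ) :
    (L.map fun p => (p.weight + 2 * x * p.dipole) * ‖phiPlus L x p.pos‖ ^ 2).sum =
      (jostWronskian L).eval x := by
  induction L with
  | nil => simp [jostWronskian, jost]
  | cons p L ih =>
    have htail : L.map (fun q => (q.weight + 2 * x * q.dipole) * ‖phiPlus (p :: L) x q.pos‖ ^ 2) =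
        L.map (fun q => (q.weight + 2 * x * q.dipole) * ‖phiPlus L x q.pos‖ ^ 2) :=
      List.map_congr_left fun q hq => by rw [phiPlus_cons_of_lt L _ (hL.lt q hq)]
    have he : Real.exp (p.pos / 2) ^ 2 = Real.exp p.pos := by
      rw [← Real.exp_nat_mul]; congr 1; push_cast; ring
    rw [List.map_cons, List.sum_cons, htail, ih hL.tail, phiPlus_cons_of_le L _ le_rfl,
      leftExp_cons, leftExp_eq, aeval_ofReal, ← Complex.ofReal_mul, Complex.norm_real,
      Real.norm_eq_abs, sq_abs, mul_pow, he, jostWronskian_cons, PointMass.strength]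
    simp
    ring

/-! ### Translation between measures and lists -/

/-- The signed measure `ω` of a list of point masses. -/
def omegaOf (L : List PointMass) : SignedMeasure ℝ :=
  (L.map fun p => VectorMeasure.dirac p.pos p.weight).sum

/-- The measure `υ` of a list of point masses. -/
def upsilonOf (L : List PointMass) : Measure ℝ :=
  (L.map fun p => ENNReal.ofReal p.dipole • Measure.dirac p.pos).sum

lemma omegaOf_cons (p : PointMass) (L : List PointMass) :
    omegaOf (p :: L) = VectorMeasure.dirac p.pos p.weight + omegaOf L := by
  rw [omegaOf, List.map_cons, List.sum_cons]; rfl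

lemma upsilonOf_cons (p : PointMass) (L : List PointMass) :
    upsilonOf (p :: L) = ENNReal.ofReal p.dipole • Measure.dirac p.pos + upsilonOf L := by
  rw [upsilonOf, List.map_cons, List.sum_cons]; rfl

lemma isDiscretePair_iff (ω : SignedMeasure ℝ) (υ : Measure ℝ) :
    IsDiscretePair ω υ ↔ ∃ L, Admissible L ∧ ω = omegaOf L ∧ υ = upsilonOf L := by
  constructor
  · rintro ⟨N, x, w, v, hx, hv, hwv, rfl, rfl⟩
    refine ⟨List.ofFn fun n => ⟨x n, w n, v n⟩, ⟨?_, ?_⟩, ?_, ?_⟩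
    · exact List.pairwise_ofFn.2 fun i j hij => hx hij
    · intro p hp
      obtain ⟨n, rfl⟩ := (List.mem_ofFn' _ _).1 hp
      exact ⟨hv n, hwv n⟩
    · rw [omegaOf, List.map_ofFn, List.sum_ofFn]; rfl
    · rw [upsilonOf, List.map_ofFn, List.sum_ofFn]; rfl
  · rintro ⟨L, hL, rfl, rfl⟩
    refine ⟨L.length, fun n => (L.get n).pos, fun n => (L.get n).weight,
      fun n => (L.get n).dipole, fun i j hij => List.pairwise_iff_get.1 hL.1 i j hij,
      fun n => (hL.2 _ (List.get_mem L n)).1, fun n => (hL.2 _ (List.get_mem L n)).2, ?_, ?_⟩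
    · rw [omegaOf, ← List.sum_ofFn]
      congr 1
      conv_lhs => rw [← List.ofFn_get L, List.map_ofFn]
      rfl
    · rw [upsilonOf, ← List.sum_ofFn]
      congr 1
      conv_lhs => rw [← List.ofFn_get L, List.map_ofFn]
      rfl

lemma omegaOf_singleton_of_notMem {L : List PointMass} {x : ℝ} (h : ∀ p ∈ L, p.pos ≠ x) :
    omegaOf L {x} = 0 := by
  induction L with
  | nil => rfl
  | cons p L ih =>
    rw [omegaOf_cons, _root_.add_apply, ih fun q hq => h q (List.mem_cons_of_mem _ hq),
      VectorMeasure.dirac_apply_of_notMem (by simpa using h p (by simp)), add_zero]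

lemma upsilonOf_singleton_of_notMem {L : List PointMass} {x : ℝ} (h : ∀ p ∈ L, p.pos ≠ x) :
    upsilonOf L {x} = 0 := by
  induction L with
  | nil => rfl
  | cons p L ih =>
    rw [upsilonOf_cons, Measure.add_apply, ih fun q hq => h q (List.mem_cons_of_mem _ hq),
      Measure.smul_apply, Measure.dirac_apply' _ (measurableSet_singleton x),
      Set.indicator_of_notMem (by simpa using h p (by simp)), smul_zero, add_zero]

lemma omegaOf_singleton {L : List PointMass} (hL : Admissible L) {p : PointMass} (hp : p ∈ L) :
    omegaOf L {p.pos} = p.weight := by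
  induction L with
  | nil => simp at hp
  | cons q L ih =>
    rw [omegaOf_cons, _root_.add_apply]
    rcases List.mem_cons.1 hp with rfl | hp
    · rw [omegaOf_singleton_of_notMem fun r hr => (hL.lt r hr).ne',
        VectorMeasure.dirac_apply_of_mem (measurableSet_singleton _) rfl, add_zero]
    · rw [ih hL.tail hp, VectorMeasure.dirac_apply_of_notMem, zero_add]
      simpa using (hL.lt p hp).ne

lemma upsilonOf_singleton {L : List PointMass} (hL : Admissible L) {p : PointMass} (hp : p ∈ L) :
    upsilonOf L {p.pos} = ENNReal.ofReal p.dipole := by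
  induction L with
  | nil => simp at hp
  | cons q L ih =>
    rw [upsilonOf_cons, Measure.add_apply, Measure.smul_apply,
      Measure.dirac_apply' _ (measurableSet_singleton _)]
    rcases List.mem_cons.1 hp with rfl | hp
    · rw [upsilonOf_singleton_of_notMem fun r hr => (hL.lt r hr).ne']
      simp
    · rw [ih hL.tail hp, Set.indicator_of_notMem (by simpa using (hL.lt p hp).ne)]
      simp

/-- The condition `|weight| + dipole > 0` ensures that no listed point is invisible to both
measures. -/
lemma mem_atoms_iff {L : List PointMass} (hL : Admissible L) (x : ℝ) :
    x ∈ atoms (omegaOf L) (upsilonOf L) ↔ ∃ p ∈ L, p.pos = x := by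
  constructor
  · intro h
    by_contra! hne
    rcases h with h | h
    · exact h (omegaOf_singleton_of_notMem hne)
    · exact h (upsilonOf_singleton_of_notMem hne)
  · rintro ⟨p, hp, rfl⟩
    by_contra h
    simp only [atoms, Set.mem_ofPred_eq, not_or, not_not, omegaOf_singleton hL hp,
      upsilonOf_singleton hL hp, ENNReal.ofReal_eq_zero] at h
    have := (hL.2 p hp).2
    rw [h.1, abs_zero, zero_add] at this
    exact absurd h.2 (not_le.2 this)

lemma isSolution_iff {L : List PointMass} (hL : Admissible L) (z : ℂ) (f : ℝ → ℂ) :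
    IsSolution (omegaOf L) (upsilonOf L) z f ↔ SolvesOn Set.univ L z f := by
  have hmass : ∀ p ∈ L, z * ((omegaOf L {p.pos} : ℝ) : ℂ) +
      z ^ 2 * (((upsilonOf L).real {p.pos} : ℝ) : ℂ) = p.mass z := fun p hp => by
    rw [omegaOf_singleton hL hp, Measure.real, upsilonOf_singleton hL hp,
      ENNReal.toReal_ofReal (hL.2 p hp).1, PointMass.mass]
  constructor
  · rintro ⟨h1, h2⟩
    refine ⟨fun t _ ht => h1 t fun hmem => ?_, fun p hp _ => ?_⟩
    · obtain ⟨p, hp, h⟩ := (mem_atoms_iff hL t).1 hmem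
      exact ht p hp h
    · have := h2 p.pos ((mem_atoms_iff hL _).2 ⟨p, hp, rfl⟩)
      rwa [hmass p hp] at this
  · rintro ⟨h1, h2⟩
    refine ⟨fun t ht => h1 t trivial fun p hp h => ht ((mem_atoms_iff hL t).2 ⟨p, hp, h⟩),
      fun t ht => ?_⟩
    obtain ⟨p, hp, rfl⟩ := (mem_atoms_iff hL t).1 ht
    rw [hmass p hp]
    exact h2 p hp trivial

lemma mem_spectrum_iff {L : List PointMass} (hL : Admissible L) (z : ℂ) :
    z ∈ spectrum (omegaOf L) (upsilonOf L) ↔ aeval z (jost L).2 = 0 := by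
  simp only [spectrum, Set.mem_ofPred_eq, isSolution_iff hL]
  exact exists_bounded_solution_iff hL z

lemma isPhiPlus_iff {L : List PointMass} (hL : Admissible L) (z : ℂ) (f : ℝ → ℂ) :
    IsPhiPlus (omegaOf L) (upsilonOf L) z f ↔ f = phiPlus L z := by
  rw [IsPhiPlus, isSolution_iff hL]
  constructor
  · rintro ⟨h1, h2⟩
    exact h1.eq_phiPlus_of_eventually hL h2
  · rintro rfl
    refine ⟨solvesOn_phiPlus hL z, ?_⟩
    obtain ⟨d, hd⟩ := exists_pos_lt L
    filter_upwards [eventually_ge_atTop d] with x hx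
    rw [phiPlus_eq_expPair z fun p hp => (hd p hp).trans_le hx]
    simp [expPair]

lemma integrable_dirac_vectorMeasure (x w : ℝ) (f : ℝ → ℝ) :
    (VectorMeasure.dirac x w).Integrable f := by
  rw [VectorMeasure.Integrable, VectorMeasure.variation_dirac]
  exact (integrable_dirac (by simp)).smul_measure (by simp)

lemma integral_omegaOf (L : List PointMass) (f : ℝ → ℝ) :
    (omegaOf L).Integrable f ∧
      VectorMeasure.integral (omegaOf L) f (ContinuousLinearMap.lsmul ℝ ℝ) =
        (L.map fun p => p.weight * f p.pos).sum := by
  induction L with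
  | nil => exact ⟨VectorMeasure.Integrable.zero_vectorMeasure,
      VectorMeasure.integral_zero_vectorMeasure⟩
  | cons p L ih =>
    have hp := integrable_dirac_vectorMeasure p.pos p.weight f
    rw [omegaOf_cons]
    refine ⟨hp.add_vectorMeasure ih.1, ?_⟩
    rw [VectorMeasure.integral_add_vectorMeasure hp ih.1, ih.2, VectorMeasure.integral_dirac,
      List.map_cons, List.sum_cons]
    simp [mul_comm]

lemma integral_upsilonOf {L : List PointMass} (hL : Admissible L) (f : ℝ → ℝ) :
    Integrable f (upsilonOf L) ∧
      ∫ x, f x ∂(upsilonOf L) = (L.map fun p => p.dipole * f p.pos).sum := by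
  induction L with
  | nil => exact ⟨integrable_zero_measure, integral_zero_measure _⟩
  | cons p L ih =>
    have hp : Integrable f (ENNReal.ofReal p.dipole • Measure.dirac p.pos) :=
      (integrable_dirac (by simp)).smul_measure (by simp)
    have ih := ih hL.tail
    rw [upsilonOf_cons]
    refine ⟨hp.add_measure ih.1, ?_⟩
    rw [integral_add_measure hp ih.1, ih.2, integral_smul_measure, integral_dirac,
      ENNReal.toReal_ofReal (hL.2 p (by simp)).1, List.map_cons, List.sum_cons, smul_eq_mul]

lemma isNormingConstant_iff {L : List PointMass} (hL : Admissible L) (x c : ℝ) :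
    IsNormingConstant (omegaOf L) (upsilonOf L) x c ↔ (jostWronskian L).eval x = c := by
  have h : VectorMeasure.integral (omegaOf L) (fun t => ‖phiPlus L x t‖ ^ 2)
      (ContinuousLinearMap.lsmul ℝ ℝ) + 2 * x * ∫ t, ‖phiPlus L x t‖ ^ 2 ∂(upsilonOf L) =
      (jostWronskian L).eval x := by
    rw [(integral_omegaOf L _).2, (integral_upsilonOf hL _).2, ← sum_norm_phiPlus_sq hL,
      ← List.sum_map_mul_left, ← List.sum_map_add]
    congr 1
    refine List.map_congr_left fun p _ => ?_
    ring
  simp only [IsNormingConstant, isPhiPlus_iff hL, exists_eq_left, h]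
  exact eq_comm

/-- At a zero of `b` the first term of the Wronskian vanishes and `-λ a(λ) b'(λ)` remains. -/
lemma hasSpectralData_iff {L : List PointMass} (hL : Admissible L) (σ : Finset ℝ) (γ : ℝ → ℝ) :
    HasSpectralData σ γ (jost L).1 (jost L).2 ↔
      spectrum (omegaOf L) (upsilonOf L) = {z : ℂ | ∃ x ∈ σ, (x : ℂ) = z} ∧
        ∀ x ∈ σ, IsNormingConstant (omegaOf L) (upsilonOf L) x (γ x) := by
  have hspec : (∀ z : ℂ, aeval z (jost L).2 = 0 ↔ ∃ x ∈ σ, (x : ℂ) = z) ↔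
      spectrum (omegaOf L) (upsilonOf L) = {z : ℂ | ∃ x ∈ σ, (x : ℂ) = z} := by
    simp only [Set.ext_iff, mem_spectrum_iff hL, Set.mem_ofPred_eq]
  have hnorm : (∀ z : ℂ, aeval z (jost L).2 = 0 ↔ ∃ x ∈ σ, (x : ℂ) = z) → ∀ x ∈ σ,
      (-(x * (jost L).1.eval x) * (derivative (jost L).2).eval x = γ x ↔
        IsNormingConstant (omegaOf L) (upsilonOf L) x (γ x)) := by
    intro h x hx
    have h0 : (jost L).2.eval x = 0 := by
      rw [← Complex.ofReal_eq_zero, ← aeval_ofReal]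
      exact (h x).2 ⟨x, hx, rfl⟩
    rw [isNormingConstant_iff hL, jostWronskian, eval_sub, eval_mul, eval_mul, eval_mul, h0,
      eval_X]
    ring_nf
  constructor
  · rintro ⟨h1, h2⟩
    exact ⟨hspec.1 h1, fun x hx => (hnorm h1 x hx).1 (h2 x hx)⟩
  · rintro ⟨h1, h2⟩
    exact ⟨hspec.2 h1, fun x hx => (hnorm (hspec.2 h1) x hx).2 (h2 x hx)⟩

end GeneralizedSpectralProblem

end

/-! ### The inverse spectral theorem -/

theorem mainTheorem2 (σ : Finset ℝ) (γsq : ℝ → ℝ) (hγ : ∀ lam ∈ σ, 0 < lam * γsq lam) :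
    ∃! p : SignedMeasure ℝ × Measure ℝ,
      GeneralizedSpectralProblem.IsDiscretePair p.1 p.2 ∧
      GeneralizedSpectralProblem.spectrum p.1 p.2 = {z : ℂ | ∃ lam ∈ σ, (lam : ℂ) = z} ∧
      ∀ lam ∈ σ, GeneralizedSpectralProblem.IsNormingConstant p.1 p.2 lam (γsq lam) := by
  open GeneralizedSpectralProblem in
  obtain ⟨A, B, hAB, hdata⟩ := exists_hasSpectralData σ γsq hγ
  obtain ⟨L, hL, hjost, -⟩ := hAB.exists_jost
  rw [show A = (jost L).1 by rw [hjost], show B = (jost L).2 by rw [hjost]] at hdata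
  refine ⟨(omegaOf L, upsilonOf L),
    ⟨(isDiscretePair_iff _ _).2 ⟨L, hL, rfl, rfl⟩, (hasSpectralData_iff hL σ γsq).1 hdata⟩, ?_⟩
  rintro ⟨ω, υ⟩ ⟨hpair, hspec⟩
  obtain ⟨L', hL', rfl, rfl⟩ := (isDiscretePair_iff _ _).1 hpair
  have hdata' := (hasSpectralData_iff hL' σ γsq).2 hspec
  obtain ⟨h1, h2⟩ := hdata'.unique hdata (fun x hx => right_ne_zero_of_mul (hγ x hx).ne')
    (jost_snd_eval_zero L') (jost_snd_eval_zero L) (degree_jost hL').1 (degree_jost hL).1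
  rw [jost_injective hL' hL (Prod.ext h1 h2)]
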